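/- Let $n\ge 1$, and let $\mathcal M_n$ and $\mathcal D_n$ be the sets of $n\times n$ complex matrices and of $n\times n$ density matrices (positive semidefinite, trace one). For a Hermitian matrix $X$ let $\lambda(X)=(\lambda_1(X),\dots,\lambda_n(X))$ be the vector of its eigenvalues in descending order, and let $\Lambda^\downarrow(X)$ and $\Lambda^\uparrow(X)$ be the diagonal matrices with the eigenvalues of $X$ on the diagonal in descending and in ascending order. For $x,y\in\mathbf R^n$ write $x\prec y$ if for $k=1,\dots,n-1$ the sum of the $k$ largest entries of $x$ is at most that of $y$, and the sums of all entries are equal. A function $d:\mathbf R^n\to\mathbf R$ is Schur-convex if $d(x)\le d(y)$ whenever $x\prec y$; it is strictly Schur-convex if moreover $d(x)<d(y)$ whenever $x\prec y$ and $x$ is not a rearrangement of the entries of $y$. A quantum channel is a map $\Phi:\mathcal M_n\to\mathcal M_n$ of the form $\Phi(X)=\sum_{j=1}^r F_jXF_j^\dagger$ with $F_1,\dots,F_r\in\mathcal M_n$ and $\sum_j F_j^\dagger F_j=I_n$; it is mixed unitary if the $F_j$ can be chosen to be multiples of unitary matrices, and unital if $\Phi(I_n)=I_n$. **Theorem.**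 Let $d:\mathbf R^n\to\mathbf R$ be Schur-convex, put $D(\sigma_1,\sigma_2)=d(\lambda(\sigma_1-\sigma_2))$ for $\sigma_1,\sigma_2\in\mathcal D_n$, let $\mathcal S$ be the set of mixed unitary channels or the set of unital channels on $\mathcal M_n$, and let $\rho_1,\rho_2\in\mathcal D_n$. Then $$\max_{\Phi\in\mathcal S}D(\rho_1,\Phi(\rho_2))=D(\Lambda^\downarrow(\rho_1),\Lambda^\uparrow(\rho_2)),\qquad \min_{\Phi\in\mathcal S}D(\rho_1,\Phi(\rho_2))=D\Bigl(\Lambda^\downarrow(\rho_1),\operatorname{diag}(d_1,\dots,d_n)\Bigr),$$ where $(d_1,\dots,d_n)$ is the output of the following algorithm, which always terminates, in which the choice in Step 2 is always possible and determines the new vector uniquely, and for which $\operatorname{diag}(d_1,\dots,d_n)\in\mathcal D_n$. * Step 0. Set $(\Delta_1,\dots,\Delta_n)=\lambda(\rho_1)-\lambda(\rho_2)$. * Step 1. If $\Delta_1\ge\cdots\ge\Delta_n$, set $(d_1,\dots,d_n)=\lambda(\rho_1)-(\Delta_1,\dots,\Delta_n)$ and stop. Otherwise go to Step 2. * Step 2.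 Let $1\le j<k\le\ell\le n$ be such that $$\Delta_1\ge\cdots\ge\Delta_{j-1}>\Delta_j=\cdots=\Delta_{k-1}<\Delta_k=\cdots=\Delta_\ell\ne\Delta_{\ell+1}$$ (the condition on $\Delta_{j-1}$ is void if $j=1$, the one on $\Delta_{\ell+1}$ is void if $\ell=n$). Replace each of $\Delta_j,\dots,\Delta_\ell$ by $(\Delta_j+\cdots+\Delta_\ell)/(\ell-j+1)$ and go to Step 1. The maximum is attained at $\Phi\in\mathcal S$ if there is a unitary $V$ with $V\rho_1V^\dagger=\Lambda^\downarrow(\rho_1)$ and $V\Phi(\rho_2)V^\dagger=\Lambda^\uparrow(\rho_2)$. The minimum is attained at $\Phi\in\mathcal S$ if there is a unitary $V$ with $V\rho_1V^\dagger=\Lambda^\downarrow(\rho_1)$ and $V\Phi(\rho_2)V^\dagger=\operatorname{diag}(d_1,\dots,d_n)$. If $d$ is strictly Schur-convex, the converses of these two statements hold. -/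

import Mathlib

open scoped Matrix ComplexOrder

noncomputable section

/-- The entries of `x` rearranged in descending order. -/
def descSort {n : ℕ} (x : Fin n → ℝ) : Fin n → ℝ :=
  x ∘ Tuple.sort (fun i => -x i)

/-- The sum of the `k` largest entries of `x`. -/
def sumLargest {n : ℕ} (x : Fin n → ℝ) (k : ℕ) : ℝ :=
  ∑ i with i.val < k, descSort x i

/-- `x ≺ y`. -/
def Majorized {n : ℕ} (x y : Fin n → ℝ) : Prop :=
  (∀ k : ℕ, 1 ≤ k → k < n → sumLargest x k ≤ sumLargest y k) ∧ ∑ i, x i = ∑ i, y i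

def SchurConvex {n : ℕ} (f : (Fin n → ℝ) → ℝ) : Prop :=
  ∀ x y, Majorized x y → f x ≤ f y

/-- Strictness is required whenever `x ≺ y` and `x` is not a rearrangement of `y`. (Rearrangements
majorize each other, so no function could be strict on them.) -/
def StrictlySchurConvex {n : ℕ} (f : (Fin n → ℝ) → ℝ) : Prop :=
  SchurConvex f ∧
    ∀ x y, Majorized x y → (¬ ∃ π : Equiv.Perm (Fin n), x = y ∘ π) → f x < f y

/-- The vector of eigenvalues of a Hermitian matrix in descending order. -/
def eigVec {n : ℕ} {X : Matrix (Fin n) (Fin n) ℂ} (hX : X.IsHermitian) : Fin n → ℝ :=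
  fun i => hX.eigenvalues₀ (Fin.cast (Fintype.card_fin n).symm i)

/-- The diagonal matrix with the given real diagonal entries. -/
def realDiag {n : ℕ} (x : Fin n → ℝ) : Matrix (Fin n) (Fin n) ℂ :=
  Matrix.diagonal fun i => (x i : ℂ)

/-- Density matrices: positive semidefinite with trace one. -/
def DensityMatrix (n : ℕ) : Type :=
  {ρ : Matrix (Fin n) (Fin n) ℂ // ρ.PosSemidef ∧ ρ.trace = 1}

namespace DensityMatrix

variable {n : ℕ}

/-- The underlying matrix. -/
def mat (ρ : DensityMatrix n) : Matrix (Fin n) (Fin n) ℂ := ρ.1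

theorem posSemidef (ρ : DensityMatrix n) : ρ.mat.PosSemidef := ρ.2.1

theorem trace_mat (ρ : DensityMatrix n) : ρ.mat.trace = 1 := ρ.2.2

theorem isHermitian (ρ : DensityMatrix n) : ρ.mat.IsHermitian := ρ.posSemidef.isHermitian

/-- `λ(ρ)`. -/
def eig (ρ : DensityMatrix n) : Fin n → ℝ := eigVec ρ.isHermitian

theorem exists_eig_eq (ρ : DensityMatrix n) :
    ∃ e : Fin n ≃ Fin n, ρ.isHermitian.eigenvalues = ρ.eig ∘ e :=
  ⟨(Fintype.equivOfCardEq (Fintype.card_fin _)).symm.trans (finCongr (Fintype.card_fin n)),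
    by ext i; rfl⟩

theorem eig_nonneg (ρ : DensityMatrix n) (i : Fin n) : 0 ≤ ρ.eig i := by
  obtain ⟨e, he⟩ := ρ.exists_eig_eq
  have := ρ.posSemidef.eigenvalues_nonneg (e.symm i)
  rw [show ρ.posSemidef.1.eigenvalues = ρ.eig ∘ e from he] at this
  simpa using this

theorem sum_eig (ρ : DensityMatrix n) : ∑ i, ρ.eig i = 1 := by
  obtain ⟨e, he⟩ := ρ.exists_eig_eq
  have h := ρ.isHermitian.trace_eq_sum_eigenvalues
  rw [ρ.trace_mat, he] at h
  simp only [Function.comp_apply] at h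
  rw [Equiv.sum_comp e (fun i => (RCLike.ofReal (ρ.eig i) : ℂ)), ← RCLike.ofReal_sum] at h
  exact (RCLike.ofReal_injective (K := ℂ) (RCLike.ofReal_one.trans h)).symm

theorem realDiag_mem {x : Fin n → ℝ} (h0 : ∀ i, 0 ≤ x i) (h1 : ∑ i, x i = 1) :
    (realDiag x).PosSemidef ∧ (realDiag x).trace = 1 := by
  refine ⟨Matrix.PosSemidef.diagonal fun i => ?_, ?_⟩
  · exact Complex.zero_le_real.2 (h0 i)
  · simp only [realDiag, Matrix.trace_diagonal]
    exact_mod_cast h1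

/-- `Λ↓(ρ)`: the diagonal matrix of the eigenvalues in descending order. -/
def diagDesc (ρ : DensityMatrix n) : DensityMatrix n :=
  ⟨realDiag ρ.eig, realDiag_mem ρ.eig_nonneg ρ.sum_eig⟩

/-- `Λ↑(ρ)`: the diagonal matrix of the eigenvalues in ascending order. -/
def diagAsc (ρ : DensityMatrix n) : DensityMatrix n :=
  ⟨realDiag fun i => ρ.eig i.rev, realDiag_mem (fun i => ρ.eig_nonneg i.rev)
    ((Equiv.sum_comp Fin.revPerm ρ.eig).trans ρ.sum_eig)⟩

end DensityMatrix

/-- `D(σ₁, σ₂) = d(λ(σ₁ - σ₂))`. -/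
def spectralD {n : ℕ} (d : (Fin n → ℝ) → ℝ) (σ₁ σ₂ : DensityMatrix n) : ℝ :=
  d (eigVec (σ₁.isHermitian.sub σ₂.isHermitian))

/-- `F₁, …, F_r` is an operator sum representation of `Φ` as a trace preserving map. -/
def IsOperatorSum {n r : ℕ} (Φ : Matrix (Fin n) (Fin n) ℂ →ₗ[ℂ] Matrix (Fin n) (Fin n) ℂ)
    (F : Fin r → Matrix (Fin n) (Fin n) ℂ) : Prop :=
  (∀ X, Φ X = ∑ j, F j * X * (F j)ᴴ) ∧ ∑ j, (F j)ᴴ * F j = 1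

/-- Quantum channels on the `n × n` complex matrices. -/
def QuantumChannel (n : ℕ) : Type :=
  {Φ : Matrix (Fin n) (Fin n) ℂ →ₗ[ℂ] Matrix (Fin n) (Fin n) ℂ //
    ∃ (r : ℕ) (F : Fin r → Matrix (Fin n) (Fin n) ℂ), IsOperatorSum Φ F}

namespace QuantumChannel

variable {n : ℕ}

/-- The underlying linear map. -/
def toMap (Φ : QuantumChannel n) :
    Matrix (Fin n) (Fin n) ℂ →ₗ[ℂ] Matrix (Fin n) (Fin n) ℂ := Φ.1

theorem toMap_mem (Φ : QuantumChannel n) (ρ : DensityMatrix n) :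
    (Φ.toMap ρ.mat).PosSemidef ∧ (Φ.toMap ρ.mat).trace = 1 := by
  obtain ⟨r, F, hF, hI⟩ := Φ.2
  have h : Φ.toMap ρ.mat = ∑ j, F j * ρ.mat * (F j)ᴴ := hF _
  rw [h]
  refine ⟨Matrix.posSemidef_sum _ fun j _ => ρ.posSemidef.mul_mul_conjTranspose_same (F j), ?_⟩
  rw [Matrix.trace_sum]
  have h2 : ∀ j, (F j * ρ.mat * (F j)ᴴ).trace = ((F j)ᴴ * F j * ρ.mat).trace := fun j => by
    rw [Matrix.trace_mul_comm, ← Matrix.mul_assoc]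
  simp_rw [h2]
  rw [← Matrix.trace_sum, ← Finset.sum_mul, hI, one_mul, ρ.trace_mat]

/-- The state `Φ(ρ)`. -/
def onState (Φ : QuantumChannel n) (ρ : DensityMatrix n) : DensityMatrix n :=
  ⟨Φ.toMap ρ.mat, Φ.toMap_mem ρ⟩

/-- Some operator sum representation consists of multiples of unitary matrices. -/
def IsMixedUnitary (Φ : QuantumChannel n) : Prop :=
  ∃ (r : ℕ) (F : Fin r → Matrix (Fin n) (Fin n) ℂ), IsOperatorSum Φ.toMap F ∧
    ∀ j, ∃ (c : ℂ) (U : Matrix (Fin n) (Fin n) ℂ),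
      U ∈ Matrix.unitaryGroup (Fin n) ℂ ∧ F j = c • U

def IsUnital (Φ : QuantumChannel n) : Prop := Φ.toMap 1 = 1

end QuantumChannel

/-- The replacement in Step 2 of the averaging algorithm. With `j < k ≤ l` such that
`Δ₁ ≥ ⋯ ≥ Δ_{j-1} > Δ_j = ⋯ = Δ_{k-1} < Δ_k = ⋯ = Δ_l ≠ Δ_{l+1}`, the entries `Δ_j, …, Δ_l` are
replaced by their average. The conditions on `Δ_{j-1}` and `Δ_{l+1}` are void if there is no such
entry. -/
def AveragingStep {n : ℕ} (Δ Δ' : Fin n → ℝ) : Prop :=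
  ∃ j k l : Fin n, j < k ∧ k ≤ l ∧
    (∀ p q : Fin n, p ≤ q → q < j → Δ q ≤ Δ p) ∧
    (∀ p : Fin n, p.val + 1 = j.val → Δ j < Δ p) ∧
    (∀ p : Fin n, j ≤ p → p < k → Δ p = Δ j) ∧
    Δ j < Δ k ∧
    (∀ p : Fin n, k ≤ p → p ≤ l → Δ p = Δ k) ∧
    (∀ p : Fin n, p.val = l.val + 1 → Δ l ≠ Δ p) ∧
    ∀ p : Fin n, Δ' p =
      if j ≤ p ∧ p ≤ l then (∑ q ∈ Finset.Icc j l, Δ q) / ((l.val : ℝ) - (j.val : ℝ) + 1) else Δ p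

/-- `AveragingRun a Δ e`: when Step 1 is entered with the vector `Δ`, some run of the algorithm
stops with the output `e`. -/
inductive AveragingRun {n : ℕ} (a : Fin n → ℝ) : (Fin n → ℝ) → (Fin n → ℝ) → Prop
  | halt (Δ : Fin n → ℝ) (h : Antitone Δ) : AveragingRun a Δ (a - Δ)
  | step (Δ Δ' e : Fin n → ℝ) (h : ¬ Antitone Δ) (hs : AveragingStep Δ Δ')
      (hr : AveragingRun a Δ' e) : AveragingRun a Δ e

/-- The algorithm, started from Step 0 on the vectors `a` and `b`, can output `e`. -/
def AveragingOutput {n : ℕ} (a b e : Fin n → ℝ) : Prop := AveragingRun a (a - b) e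

end

/-! Everything is a statement about the majorization order on the vectors λ(ρ₁ - Φ(ρ₂)). For unital
Φ the diagonal of Φ(ρ₂) in any orthonormal basis is a doubly stochastic image of λ(ρ₂)
(`QuantumChannel.IsUnital.isAverage_reDiag`). Conversely, by Rado's theorem, every vector majorized
by λ(ρ₂) is the spectrum of a mixed unitary image of ρ₂, diagonal in a basis of choice
(`DensityMatrix.exists_isMixedUnitary_conj_eq`). So the bounds can be proved for unital channels and
attained by mixed unitary ones.

Maximum: in an eigenbasis of ρ₁ - Φ(ρ₂) the spectrum is a difference of two diagonals. Their prefix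
sums are bounded above by those of λ(ρ₁) and below by those of the ascending λ(ρ₂).

Minimum: put a = λ(ρ₁), b = λ(ρ₂) and μ = λ(Φ(ρ₂)) ≺ b. Lidskii's theorem gives a - μ ≺ λ(ρ₁ -
Φ(ρ₂)), so the least a - μ is wanted. The prefix sums of a - μ lie above those of a - b, and a
descending vector is one with concave prefix sums. The algorithm computes the least concave
majorant: its final vector Γ is descending, and its prefix sums lie above those of a - b and touch
them wherever Γ changes (`IsTouchingMajorant`). Hence Γ ≺ a - μ, while a - Γ is descending and
majorized by b, so it is realized by a channel.

Equality: strict Schur-convexity forces equality of the sorted vectors. All prefix sum estimates are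
then tight, the diagonals are the spectra, and the Frobenius norm leaves nothing off the diagonal
(`conj_eq_realDiag_of_add`). -/

noncomputable section

/-- The sum of the first `k` entries of `x`. -/
def prefixSum {n : ℕ} (x : Fin n → ℝ) (k : ℕ) : ℝ :=
  ∑ i with i.val < k, x i

/-! ### Prefix sums and summation by parts -/

section PrefixSum

variable {n : ℕ}

theorem prefixSum_eq_sum_ite (x : Fin n → ℝ) (k : ℕ) :
    prefixSum x k = ∑ i, if i.val < k then x i else 0 := by
  rw [prefixSum, Finset.sum_filter]

theorem prefixSum_zero (x : Fin n → ℝ) : prefixSum x 0 = 0 := by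
  simp [prefixSum]

theorem prefixSum_of_le (x : Fin n → ℝ) {k : ℕ} (h : n ≤ k) : prefixSum x k = ∑ i, x i := by
  rw [prefixSum_eq_sum_ite]
  exact Finset.sum_congr rfl fun i _ => if_pos (i.2.trans_le h)

theorem prefixSum_add (x y : Fin n → ℝ) (k : ℕ) :
    prefixSum (x + y) k = prefixSum x k + prefixSum y k := by
  simp [prefixSum, Finset.sum_add_distrib]

theorem prefixSum_sub (x y : Fin n → ℝ) (k : ℕ) :
    prefixSum (x - y) k = prefixSum x k - prefixSum y k := by
  simp [prefixSum, Finset.sum_sub_distrib]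

theorem prefixSum_neg (x : Fin n → ℝ) (k : ℕ) : prefixSum (-x) k = -prefixSum x k := by
  simp [prefixSum]

theorem prefixSum_succ (x : Fin n → ℝ) (i : Fin n) :
    prefixSum x (i.val + 1) = prefixSum x i.val + x i := by
  have h : (Finset.univ.filter fun j : Fin n => j.val < i.val + 1) =
      insert i (Finset.univ.filter fun j : Fin n => j.val < i.val) := by
    ext j
    simp only [Finset.mem_filter, Finset.mem_univ, true_and, Finset.mem_insert, Fin.ext_iff]
    omega
  rw [prefixSum, h, Finset.sum_insert (by simp), prefixSum, add_comm]

theorem prefixSum_injective {x y : Fin n → ℝ} (h : ∀ k, prefixSum x k = prefixSum y k) :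
    x = y := by
  ext i
  have h1 := prefixSum_succ x i
  have h2 := prefixSum_succ y i
  rw [h, h] at h1
  linarith

/-- The sum of an antitone vector with weights in `[0, 1]` of total weight `k` is at most the sum
of its first `k` entries. -/
theorem sum_mul_le_prefixSum {z w : Fin n → ℝ} (hz : Antitone z) (h0 : ∀ i, 0 ≤ w i)
    (h1 : ∀ i, w i ≤ 1) {k : ℕ} (hk : ∑ i, w i = k) : ∑ i, w i * z i ≤ prefixSum z k := by
  have hkn : k ≤ n := by
    have : ∑ i, w i ≤ ∑ _i : Fin n, (1 : ℝ) := Finset.sum_le_sum fun i _ => h1 i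
    rw [hk] at this
    simpa using this
  -- A threshold `c` separating the first `k` entries of `z` from the others; the index is capped at
  -- `n - 1` to cover `k = n`. Both weight vectors have total `k`, so subtracting `c` from `z`
  -- leaves the comparison unchanged and makes it termwise.
  obtain ⟨c, hc1, hc2⟩ : ∃ c : ℝ, (∀ i : Fin n, i.val < k → c ≤ z i) ∧
      ∀ i : Fin n, k ≤ i.val → z i ≤ c := by
    rcases Nat.eq_zero_or_pos n with rfl | hn
    · exact ⟨0, fun i => i.elim0, fun i => i.elim0⟩
    · refine ⟨z ⟨min k (n - 1), by omega⟩, fun i hi => hz ?_, fun i hi => hz ?_⟩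
      · rw [Fin.le_def]; dsimp only; omega
      · rw [Fin.le_def]; dsimp only; omega
  have hcount : ∑ i : Fin n, (if i.val < k then (1 : ℝ) else 0) = k := by
    rw [← Finset.sum_filter, Finset.sum_const, nsmul_eq_mul, mul_one]
    simp [Fin.card_filter_val_lt, hkn]
  have key : 0 ≤ ∑ i : Fin n, ((if i.val < k then (1 : ℝ) else 0) - w i) * (z i - c) := by
    refine Finset.sum_nonneg fun i _ => ?_
    split_ifs with h
    · exact mul_nonneg (by linarith [h1 i]) (by linarith [hc1 i h])
    · exact mul_nonneg_of_nonpos_of_nonpos (by linarith [h0 i]) (by linarith [hc2 i (not_lt.1 h)])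
  have e : ∑ i : Fin n, ((if i.val < k then (1 : ℝ) else 0) - w i) * (z i - c) =
      prefixSum z k - ∑ i, w i * z i -
        (∑ i : Fin n, (if i.val < k then (1 : ℝ) else 0) - ∑ i, w i) * c := by
    rw [prefixSum_eq_sum_ite, ← Finset.sum_sub_distrib, ← Finset.sum_sub_distrib, Finset.sum_mul,
      ← Finset.sum_sub_distrib]
    refine Finset.sum_congr rfl fun i _ => ?_
    split_ifs <;> ring
  rw [e, hcount, hk] at key
  linarith

/-- Summation by parts. -/
theorem sum_mul_nonneg_of_prefixSum {c δ : Fin n → ℝ} (hδ : ∑ i, δ i = 0)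
    (h : ∀ i j : Fin n, j.val = i.val + 1 → 0 ≤ (c i - c j) * prefixSum δ j.val) :
    0 ≤ ∑ i, c i * δ i := by
  rcases Nat.eq_zero_or_pos n with rfl | hn
  · simp
  -- The difference of the two sides is the sum of the terms in `h` met so far. At the last index
  -- the left side vanishes by `hδ`.
  have key : ∀ m (hm : m < n), c ⟨m, hm⟩ * prefixSum δ (m + 1) ≤
      prefixSum (fun i => c i * δ i) (m + 1) := by
    intro m
    induction m with
    | zero =>
      intro hm
      rw [prefixSum_succ δ ⟨0, hm⟩, prefixSum_succ (fun i => c i * δ i) ⟨0, hm⟩]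
      simp [prefixSum_zero]
    | succ m ih =>
      intro hm
      rw [prefixSum_succ δ ⟨m + 1, hm⟩, prefixSum_succ (fun i => c i * δ i) ⟨m + 1, hm⟩]
      have h1 := ih (by omega)
      have h2 := h ⟨m, by omega⟩ ⟨m + 1, hm⟩ rfl
      dsimp only at h2 ⊢
      nlinarith
  have := key (n - 1) (by omega)
  rw [prefixSum_of_le _ (by omega), prefixSum_of_le _ (by omega), hδ] at this
  simpa using this

end PrefixSum

/-! ### Majorization, doubly stochastic averages and Rado's theorem -/

section Majorization

variable {n : ℕ}

theorem descSort_antitone (x : Fin n → ℝ) : Antitone (descSort x) := by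
  have h := Tuple.monotone_sort fun i => -x i
  intro i j hij
  have := h hij
  simpa [descSort] using this

theorem descSort_of_antitone {x : Fin n → ℝ} (hx : Antitone x) : descSort x = x := by
  have : Tuple.sort (fun i => -x i) = Equiv.refl _ :=
    Tuple.sort_eq_refl_iff_monotone.2 fun i j hij => neg_le_neg (hx hij)
  rw [descSort, this]
  rfl

theorem sumLargest_of_antitone {x : Fin n → ℝ} (hx : Antitone x) (k : ℕ) :
    sumLargest x k = prefixSum x k := by
  rw [sumLargest, descSort_of_antitone hx, prefixSum]

theorem sumLargest_eq_prefixSum (x : Fin n → ℝ) (k : ℕ) :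
    sumLargest x k = prefixSum (descSort x) k := rfl

theorem sum_descSort (x : Fin n → ℝ) : ∑ i, descSort x i = ∑ i, x i :=
  Equiv.sum_comp (Tuple.sort fun i => -x i) x

/-- With `exists_sumLargest_eq` this makes `sumLargest` a maximum of linear functionals, so that
later comparisons transport weights instead of sorting. -/
theorem sum_mul_le_sumLargest {z w : Fin n → ℝ} (h0 : ∀ i, 0 ≤ w i)
    (h1 : ∀ i, w i ≤ 1) {k : ℕ} (hk : ∑ i, w i = k) : ∑ i, w i * z i ≤ sumLargest z k := by
  set π := Tuple.sort fun i => -z i with hπ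
  rw [← Equiv.sum_comp π]
  exact sum_mul_le_prefixSum (w := w ∘ π) (descSort_antitone z) (fun i => h0 _) (fun i => h1 _)
    ((Equiv.sum_comp π w).trans hk)

theorem prefixSum_le_sumLargest (z : Fin n → ℝ) (k : ℕ) : prefixSum z k ≤ sumLargest z k := by
  rcases le_total n k with h | h
  · rw [sumLargest_eq_prefixSum, prefixSum_of_le _ h, prefixSum_of_le _ h, sum_descSort]
  · have := sum_mul_le_sumLargest (z := z) (w := fun i => if i.val < k then 1 else 0) (k := k)
      (fun i => by split_ifs <;> simp) (fun i => by split_ifs <;> simp) (by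
        rw [← Finset.sum_filter, Finset.sum_const, nsmul_eq_mul, mul_one]
        simp [Fin.card_filter_val_lt, h])
    rw [prefixSum_eq_sum_ite]
    simpa using this

/-- The sum of the `k` largest entries is a sum with zero-one weights. -/
theorem exists_sumLargest_eq (z : Fin n → ℝ) {k : ℕ} (hk : k ≤ n) :
    ∃ w : Fin n → ℝ, (∀ i, 0 ≤ w i) ∧ (∀ i, w i ≤ 1) ∧ ∑ i, w i = k ∧
      ∑ i, w i * z i = sumLargest z k := by
  set π := Tuple.sort fun i => -z i with hπ
  refine ⟨fun i => if (π.symm i).val < k then 1 else 0, fun i => by dsimp only; split_ifs <;> simp,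
    fun i => by dsimp only; split_ifs <;> simp, ?_, ?_⟩
  · rw [← Equiv.sum_comp π]
    simp only [Equiv.symm_apply_apply]
    rw [← Finset.sum_filter, Finset.sum_const, nsmul_eq_mul, mul_one]
    simp [Fin.card_filter_val_lt, hk]
  · rw [← Equiv.sum_comp π]
    simp only [Equiv.symm_apply_apply]
    rw [sumLargest_eq_prefixSum, prefixSum_eq_sum_ite]
    exact Finset.sum_congr rfl fun i _ => by split_ifs <;> simp [descSort, hπ]

theorem Majorized.sumLargest_le {x y : Fin n → ℝ} (h : Majorized x y) (k : ℕ) :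
    sumLargest x k ≤ sumLargest y k := by
  rcases Nat.eq_zero_or_pos k with rfl | h0
  · simp [sumLargest_eq_prefixSum, prefixSum_zero]
  rcases le_or_gt n k with hk | hk
  · rw [sumLargest_eq_prefixSum, sumLargest_eq_prefixSum, prefixSum_of_le _ hk,
      prefixSum_of_le _ hk, sum_descSort, sum_descSort, h.2]
  · exact h.1 k h0 hk

theorem Majorized.prefixSum_le {x y : Fin n → ℝ} (h : Majorized x y) (hy : Antitone y) (k : ℕ) :
    prefixSum x k ≤ prefixSum y k :=
  (prefixSum_le_sumLargest x k).trans ((h.sumLargest_le k).trans_eq (sumLargest_of_antitone hy k))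

theorem Majorized.trans {x y z : Fin n → ℝ} (h : Majorized x y) (h' : Majorized y z) :
    Majorized x z :=
  ⟨fun k _ _ => (h.sumLargest_le k).trans (h'.sumLargest_le k), h.2.trans h'.2⟩

theorem Majorized.of_prefixSum_le {x y : Fin n → ℝ} (hx : Antitone x)
    (h : ∀ k, prefixSum x k ≤ prefixSum y k) (hs : ∑ i, x i = ∑ i, y i) : Majorized x y :=
  ⟨fun k _ _ => (sumLargest_of_antitone hx k).trans_le ((h k).trans (prefixSum_le_sumLargest y k)),
    hs⟩

/-- A prefix sum of a permuted vector is a sum with zero-one weights, hence at most that of the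
sorted vector; the roles are symmetric. -/
theorem eq_of_antitone_of_comp_perm {x y : Fin n → ℝ} (hx : Antitone x) (hy : Antitone y)
    {π : Equiv.Perm (Fin n)} (h : x = y ∘ π) : x = y := by
  have h1 : ∀ {u v : Fin n → ℝ} (σ : Equiv.Perm (Fin n)), Antitone v → u = v ∘ σ →
      ∀ k, prefixSum u k ≤ prefixSum v k := by
    intro u v σ hv huv k
    rcases le_total n k with hk | hk
    · rw [prefixSum_of_le _ hk, prefixSum_of_le _ hk, huv]
      exact (Equiv.sum_comp σ v).le
    · rw [prefixSum_eq_sum_ite, huv, ← Equiv.sum_comp σ.symm]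
      have := sum_mul_le_prefixSum (z := v) (k := k)
        (w := fun i => if (σ.symm i).val < k then 1 else 0) hv
        (fun i => by split_ifs <;> simp) (fun i => by split_ifs <;> simp) (by
          rw [Equiv.sum_comp σ.symm (fun i => if i.val < k then (1 : ℝ) else 0),
            ← Finset.sum_filter, Finset.sum_const, nsmul_eq_mul, mul_one]
          simp [Fin.card_filter_val_lt, hk])
      simpa using this
  refine prefixSum_injective fun k => le_antisymm (h1 π hy h k) (h1 π.symm hx ?_ k)
  rw [h]
  ext i
  simp

theorem StrictlySchurConvex.eq_comp_perm {f : (Fin n → ℝ) → ℝ} (hf : StrictlySchurConvex f)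
    {x y : Fin n → ℝ} (h : Majorized x y) (he : f x = f y) : ∃ π : Equiv.Perm (Fin n), x = y ∘ π :=
  by_contra fun hn => (hf.2 x y h hn).ne he

/-- `x` is the image of `y` under a doubly stochastic matrix. -/
def IsAverage (x y : Fin n → ℝ) : Prop :=
  ∃ P ∈ doublyStochastic ℝ (Fin n), x = P *ᵥ y

theorem IsAverage.trans {x y z : Fin n → ℝ} (h : IsAverage x y) (h' : IsAverage y z) :
    IsAverage x z := by
  obtain ⟨P, hP, rfl⟩ := h
  obtain ⟨Q, hQ, rfl⟩ := h'
  exact ⟨P * Q, mul_mem hP hQ, by rw [Matrix.mulVec_mulVec]⟩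

theorem IsAverage.neg {x y : Fin n → ℝ} (h : IsAverage x y) : IsAverage (-x) (-y) := by
  obtain ⟨P, hP, rfl⟩ := h
  exact ⟨P, hP, by rw [Matrix.mulVec_neg]⟩

/-- Weights for `P *ᵥ y` pull back along `P` to weights for `y`: column sums keep them in `[0, 1]`
and row sums keep their total. -/
theorem IsAverage.majorized {x y : Fin n → ℝ} (h : IsAverage x y) : Majorized x y := by
  obtain ⟨P, hP, rfl⟩ := h
  refine ⟨fun k _ hk => ?_, sum_mulVec_of_mem_doublyStochastic hP⟩
  obtain ⟨w, hw0, hw1, hws, hwz⟩ := exists_sumLargest_eq (P *ᵥ y) hk.le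
  have e : ∑ i, w i * (P *ᵥ y) i = ∑ j, (∑ i, w i * P i j) * y j := by
    simp only [Matrix.mulVec, dotProduct, Finset.mul_sum, Finset.sum_mul]
    rw [Finset.sum_comm]
    simp only [mul_assoc]
  rw [← hwz, e]
  refine sum_mul_le_sumLargest (fun j => Finset.sum_nonneg fun i _ =>
    mul_nonneg (hw0 i) (nonneg_of_mem_doublyStochastic hP)) (fun j => ?_) ?_
  · rw [← sum_col_of_mem_doublyStochastic hP j]
    exact Finset.sum_le_sum fun i _ =>
      mul_le_of_le_one_left (nonneg_of_mem_doublyStochastic hP) (hw1 i)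
  · rw [Finset.sum_comm, ← hws]
    refine Finset.sum_congr rfl fun i _ => ?_
    rw [← Finset.mul_sum, sum_row_of_mem_doublyStochastic hP, mul_one]

theorem IsAverage.eq_of_antitone {x y : Fin n → ℝ} (h : IsAverage x y) (h' : IsAverage y x)
    (hx : Antitone x) (hy : Antitone y) : x = y :=
  prefixSum_injective fun k => le_antisymm (h.majorized.prefixSum_le hy k)
    (h'.majorized.prefixSum_le hx k)

theorem antitone_neg_comp_rev {b : Fin n → ℝ} (hb : Antitone b) :
    Antitone fun i : Fin n => -b i.rev :=
  fun _ _ hij => neg_le_neg (hb (Fin.rev_le_rev.2 hij))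

theorem sumLargest_comp_perm (x : Fin n → ℝ) (π : Equiv.Perm (Fin n)) (k : ℕ) :
    sumLargest (x ∘ π) k = sumLargest x k := by
  have h : descSort (x ∘ π) = descSort x := by
    refine eq_of_antitone_of_comp_perm (descSort_antitone _) (descSort_antitone _)
      (π := ((Tuple.sort fun i => -(x ∘ π) i).trans π).trans (Tuple.sort fun i => -x i).symm) ?_
    ext i
    simp [descSort]
  rw [sumLargest, h, sumLargest]

/-- Majorization of the negatives: the `k` largest entries of `-b` come from the `k` smallest of
`b`, which the reversed vector lists first. -/
theorem IsAverage.prefixSum_rev_le {x b : Fin n → ℝ} (h : IsAverage x b) (hb : Antitone b)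
    (k : ℕ) : prefixSum (fun i => b i.rev) k ≤ prefixSum x k := by
  have h1 := (prefixSum_le_sumLargest (-x) k).trans (h.neg.majorized.sumLargest_le k)
  rw [← sumLargest_comp_perm (-b) Fin.revPerm k] at h1
  have h2 := sumLargest_of_antitone (antitone_neg_comp_rev hb) k
  have h3 : (-b) ∘ ⇑Fin.revPerm = fun i : Fin n => -b i.rev := rfl
  rw [h3, h2, prefixSum_neg] at h1
  have h4 : (fun i : Fin n => -b i.rev) = -fun i : Fin n => b i.rev := rfl
  rw [h4, prefixSum_neg] at h1
  linarith

theorem Majorized.sum_mul_le {x y c : Fin n → ℝ} (h : Majorized x y) (hy : Antitone y)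
    (hc : Antitone c) : ∑ i, c i * x i ≤ ∑ i, c i * y i := by
  have := sum_mul_nonneg_of_prefixSum (c := c) (δ := y - x)
    (by simp [Finset.sum_sub_distrib, h.2]) fun i j hij => by
      refine mul_nonneg (sub_nonneg.2 (hc (Fin.le_def.2 (by omega)))) ?_
      rw [prefixSum_sub]
      linarith [h.prefixSum_le hy j.val]
  simpa [mul_sub, Finset.sum_sub_distrib] using this

/-- ⟨x, x⟩ ≤ ⟨x, y⟩ ≤ ⟨y, y⟩, by the linear inequality with coefficients `x` and then `y`. -/
theorem Majorized.sum_sq_le {x y : Fin n → ℝ} (h : Majorized x y) (hx : Antitone x)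
    (hy : Antitone y) : ∑ i, x i ^ 2 ≤ ∑ i, y i ^ 2 := by
  have h1 := h.sum_mul_le hy hx
  have h2 := h.sum_mul_le hy hy
  have h3 : ∑ i, y i * x i = ∑ i, x i * y i := Finset.sum_congr rfl fun i _ => mul_comm _ _
  simp only [sq]
  linarith

/-- Rado's theorem: a vector majorized by `y` is a convex combination of rearrangements of `y`. -/
theorem Majorized.exists_perm_weights {x y : Fin n → ℝ} (h : Majorized x y) :
    ∃ w : Equiv.Perm (Fin n) → ℝ, (∀ π, 0 ≤ w π) ∧ ∑ π, w π = 1 ∧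
      ∀ i, x i = ∑ π, w π * y (π i) := by
  classical
  set v : Equiv.Perm (Fin n) → Fin n → ℝ := fun π => y ∘ π with hv
  have hx : x ∈ convexHull ℝ (Set.range v) := by
    by_contra hx
    obtain ⟨f, u, hfu, hux⟩ := geometric_hahn_banach_closed_point (convex_convexHull ℝ _)
      ((Set.finite_range v).isClosed_convexHull ℝ) hx
    set c : Fin n → ℝ := fun i => f (Pi.single i 1) with hc
    have hf : ∀ z : Fin n → ℝ, f z = ∑ i, c i * z i := fun z => by
      conv_lhs => rw [← Finset.univ_sum_single z]
      rw [map_sum]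
      refine Finset.sum_congr rfl fun i _ => ?_
      have : Pi.single i (z i) = z i • (Pi.single i 1 : Fin n → ℝ) := by
        rw [← Pi.single_smul', smul_eq_mul, mul_one]
      rw [this, map_smul, smul_eq_mul, mul_comm]
    set τ := Tuple.sort fun i => -c i with hτ
    set σ := Tuple.sort fun i => -y i with hσ
    -- Arranging `y` in the same order as the coefficients `c` of the separating functional gives a
    -- value at least `f x`, against the separation.
    have h1 : f x ≤ f (v (τ.symm.trans σ)) := by
      rw [hf, hf, ← Equiv.sum_comp τ, ← Equiv.sum_comp τ (fun i => c i * v _ i)]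
      have hmaj : Majorized (x ∘ τ) (descSort y) := by
        refine ⟨fun k h1 h2 => ?_, ?_⟩
        · rw [sumLargest_comp_perm, sumLargest_of_antitone (descSort_antitone y),
            ← sumLargest_eq_prefixSum]
          exact h.1 k h1 h2
        · rw [sum_descSort, ← h.2]
          exact Equiv.sum_comp τ x
      have := hmaj.sum_mul_le (descSort_antitone y) (descSort_antitone c)
      refine this.trans_eq (Finset.sum_congr rfl fun i _ => ?_)
      simp [descSort, hv, ← hτ, ← hσ]
    have h2 := hfu _ (subset_convexHull ℝ _ ⟨τ.symm.trans σ, rfl⟩)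
    linarith
  rw [convexHull_range_eq_exists_affineCombination] at hx
  obtain ⟨s, w, hw0, hw1, hwx⟩ := hx
  refine ⟨fun π => if π ∈ s then w π else 0, fun π => ?_, ?_, fun i => ?_⟩
  · dsimp only
    split_ifs with hπ
    exacts [hw0 π hπ, le_rfl]
  · simpa using hw1
  · rw [s.affineCombination_eq_linear_combination v w hw1] at hwx
    rw [← hwx]
    simp [hv, Finset.sum_apply]

end Majorization

/-! ### The averaging algorithm -/

section Averaging

variable {n : ℕ}

theorem le_of_adjacent_le {Δ : Fin n → ℝ} {B : ℕ}
    (h : ∀ i j : Fin n, j.val = i.val + 1 → j.val < B → Δ j ≤ Δ i) {p q : Fin n} (hpq : p ≤ q)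
    (hq : q.val < B) : Δ q ≤ Δ p := by
  have key : ∀ m (hm : p.val + m < n), p.val + m < B → Δ ⟨p.val + m, hm⟩ ≤ Δ p := by
    intro m
    induction m with
    | zero => exact fun _ _ => le_rfl
    | succ m ih =>
      exact fun hm hB => (h ⟨p.val + m, by omega⟩ ⟨p.val + (m + 1), hm⟩ rfl hB).trans
        (ih (by omega) (by omega))
  have hpq' : p.val ≤ q.val := hpq
  have hq' : p.val + (q.val - p.val) = q.val := by omega
  have := key (q.val - p.val) (by omega) (by omega)
  simpa only [hq'] using this

theorem antitone_of_adjacent_le {Δ : Fin n → ℝ}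
    (h : ∀ i j : Fin n, j.val = i.val + 1 → Δ j ≤ Δ i) : Antitone Δ :=
  fun _ q hpq => le_of_adjacent_le (B := n) (fun i j hij _ => h i j hij) hpq q.2

/-- Take for `k` the first ascent, for `j` the start of the constant run ending just before `k`, and
for `l` the end of the constant run starting at `k`. -/
theorem exists_averagingStep {Δ : Fin n → ℝ} (h : ¬ Antitone Δ) : ∃ Δ', AveragingStep Δ Δ' := by
  classical
  obtain ⟨k, ⟨p, hpk, hlt⟩, hkmin⟩ :
      ∃ k : Fin n, (∃ p : Fin n, p.val + 1 = k.val ∧ Δ p < Δ k) ∧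
        ∀ q < k, ¬ ∃ p : Fin n, p.val + 1 = q.val ∧ Δ p < Δ q := by
    refine WellFounded.has_min (wellFounded_lt (α := Fin n))
      {k | ∃ p : Fin n, p.val + 1 = k.val ∧ Δ p < Δ k} ?_ |>.imp fun k hk =>
        ⟨hk.1, fun q hq hq' => hk.2 q hq' hq⟩
    by_contra hne
    refine h (antitone_of_adjacent_le fun i j hij => le_of_not_gt fun hlt => hne ⟨j, i, ?_, hlt⟩)
    exact hij.symm
  have hanti : ∀ p q : Fin n, p ≤ q → q.val < k.val → Δ q ≤ Δ p := fun p q hpq hq =>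
    le_of_adjacent_le (B := k.val) (fun i j hij hj => le_of_not_gt fun hlt =>
      hkmin j hj ⟨i, hij.symm, hlt⟩) hpq hq
  obtain ⟨j, ⟨hjk, hjeq⟩, hjmin⟩ :
      ∃ j : Fin n, (j < k ∧ ∀ p, j ≤ p → p < k → Δ p = Δ j) ∧
        ∀ q < j, ¬ (q < k ∧ ∀ p, q ≤ p → p < k → Δ p = Δ q) := by
    refine WellFounded.has_min (wellFounded_lt (α := Fin n))
      {j | j < k ∧ ∀ p, j ≤ p → p < k → Δ p = Δ j} ⟨p, ?_, ?_⟩ |>.imp fun k hk =>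
        ⟨hk.1, fun q hq hq' => hk.2 q hq' hq⟩
    · rw [Fin.lt_def]; omega
    · intro q h1 h2
      have : q = p := by
        rw [Fin.le_def] at h1
        rw [Fin.lt_def] at h2
        exact Fin.ext (by omega)
      rw [this]
  obtain ⟨l, ⟨hkl, hleq⟩, hlmax⟩ :
      ∃ l : Fin n, (k ≤ l ∧ ∀ p, k ≤ p → p ≤ l → Δ p = Δ k) ∧
        ∀ q > l, ¬ (k ≤ q ∧ ∀ p, k ≤ p → p ≤ q → Δ p = Δ k) := by
    refine WellFounded.has_min (wellFounded_gt (α := Fin n))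
      {l | k ≤ l ∧ ∀ p, k ≤ p → p ≤ l → Δ p = Δ k} ⟨k, le_rfl, ?_⟩ |>.imp fun k hk =>
        ⟨hk.1, fun q hq hq' => hk.2 q hq' hq⟩
    intro q h1 h2
    rw [le_antisymm h2 h1]
  refine ⟨_, j, k, l, hjk, hkl, fun p q hpq hq => hanti p q hpq (hq.trans hjk), ?_, hjeq, ?_,
    hleq, ?_, fun _ => rfl⟩
  · intro q hq
    have hqj : q < j := by rw [Fin.lt_def]; omega
    refine lt_of_le_of_ne (hanti q j hqj.le hjk) fun he => hjmin q hqj ⟨hqj.trans hjk, ?_⟩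
    intro r h1 h2
    rcases h1.eq_or_lt with rfl | h1
    · rfl
    · rw [← he]
      exact hjeq r (by rw [Fin.le_def]; rw [Fin.lt_def] at h1; omega) h2
  · rwa [← hjeq p (by rw [Fin.le_def]; rw [Fin.lt_def] at hjk; omega) (by rw [Fin.lt_def]; omega)]
  · intro q hq he
    refine hlmax q (by rw [gt_iff_lt, Fin.lt_def]; omega)
      ⟨hkl.trans (by rw [Fin.le_def]; omega), fun r h1 h2 => ?_⟩
    rcases le_or_gt r l with h3 | h3
    · exact hleq r h1 h3
    · have : r = q := Fin.ext (by rw [Fin.le_def] at h2; rw [Fin.lt_def] at h3; omega)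
      rw [this, ← he]
      exact hleq l hkl le_rfl

theorem AveragingStep.unique {Δ Δ₁ Δ₂ : Fin n → ℝ} (h₁ : AveragingStep Δ Δ₁)
    (h₂ : AveragingStep Δ Δ₂) : Δ₁ = Δ₂ := by
  -- Both choices must use the first ascent. If `k < k'`, the ascent at `k` would fall inside the
  -- constant run from `j'`, on the strict descent into `j'`, or in the descending part before `j'`.
  have hk : ∀ j k j' k' : Fin n, j < k → (∀ p, j ≤ p → p < k → Δ p = Δ j) → Δ j < Δ k →
      (∀ p q : Fin n, p ≤ q → q < j' → Δ q ≤ Δ p) →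
      (∀ p : Fin n, p.val + 1 = j'.val → Δ j' < Δ p) →
      (∀ p, j' ≤ p → p < k' → Δ p = Δ j') → ¬ k < k' := by
    intro j k j' k' hjk h1 h2 h3 h4 h5 hlt
    rw [Fin.lt_def] at hjk hlt
    obtain ⟨p, hp⟩ : ∃ p : Fin n, p.val + 1 = k.val := ⟨⟨k.val - 1, by omega⟩, by dsimp only; omega⟩
    have hpj : Δ p = Δ j := h1 p (by rw [Fin.le_def]; omega) (by rw [Fin.lt_def]; omega)
    rcases lt_trichotomy j'.val k.val with h6 | h6 | h6
    · have e1 := h5 p (by rw [Fin.le_def]; omega) (by rw [Fin.lt_def]; omega)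
      have e2 := h5 k (by rw [Fin.le_def]; omega) (by rw [Fin.lt_def]; omega)
      linarith
    · have := h4 p (by omega)
      rw [Fin.ext h6] at this
      linarith
    · have := h3 p k (by rw [Fin.le_def]; omega) h6
      linarith
  have hj : ∀ j j' k : Fin n, j' < k → (∀ p, j ≤ p → p < k → Δ p = Δ j) →
      (∀ p : Fin n, p.val + 1 = j'.val → Δ j' < Δ p) → ¬ j < j' := by
    intro j j' k h1 h2 h3 hlt
    rw [Fin.lt_def] at hlt h1
    obtain ⟨p, hp⟩ : ∃ p : Fin n, p.val + 1 = j'.val :=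
      ⟨⟨j'.val - 1, by omega⟩, by dsimp only; omega⟩
    have e1 := h2 p (by rw [Fin.le_def]; omega) (by rw [Fin.lt_def]; omega)
    have e2 := h2 j' hlt.le h1
    have := h3 p hp
    linarith
  have hl : ∀ k l l' : Fin n, k ≤ l → (∀ p, k ≤ p → p ≤ l' → Δ p = Δ k) →
      (∀ p : Fin n, p.val = l.val + 1 → Δ l ≠ Δ p) → ¬ l < l' := by
    intro k l l' h1 h2 h3 hlt
    rw [Fin.lt_def] at hlt
    rw [Fin.le_def] at h1
    obtain ⟨p, hp⟩ : ∃ p : Fin n, p.val = l.val + 1 := ⟨⟨l.val + 1, by omega⟩, rfl⟩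
    refine h3 p hp ?_
    rw [h2 l h1 hlt.le, h2 p (by rw [Fin.le_def]; omega) (by rw [Fin.le_def]; omega)]
  obtain ⟨j, k, l, hjk, hkl, a1, a2, a3, a4, a5, a6, a7⟩ := h₁
  obtain ⟨j', k', l', hjk', hkl', b1, b2, b3, b4, b5, b6, b7⟩ := h₂
  obtain rfl : k = k' := le_antisymm (not_lt.1 (hk j' k' j k hjk' b3 b4 a1 a2 a3))
    (not_lt.1 (hk j k j' k' hjk a3 a4 b1 b2 b3))
  obtain rfl : j = j' := le_antisymm (not_lt.1 (hj j' j k hjk b3 a2))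
    (not_lt.1 (hj j j' k hjk' a3 b2))
  obtain rfl : l = l' := le_antisymm (not_lt.1 (hl k l' l hkl' a5 b6))
    (not_lt.1 (hl k l l' hkl b5 a6))
  ext p
  rw [a7, b7]

/-- The partial sums of `Δ` lie above those of `Δ₀` and agree with them wherever `Δ` changes. -/
structure IsTouchingMajorant (Δ₀ Δ : Fin n → ℝ) : Prop where
  prefixSum_le : ∀ k, prefixSum Δ₀ k ≤ prefixSum Δ k
  sum_eq : ∑ i, Δ i = ∑ i, Δ₀ i
  touch : ∀ i j : Fin n, j.val = i.val + 1 → Δ i ≠ Δ j → prefixSum Δ j.val = prefixSum Δ₀ j.val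

theorem IsTouchingMajorant.refl (Δ : Fin n → ℝ) : IsTouchingMajorant Δ Δ :=
  ⟨fun _ => le_rfl, rfl, fun _ _ _ _ => rfl⟩

/-- The average lies between the values of the two runs, so it raises the first and lowers the
second. Invariance and termination use only these consequences of the step. -/
theorem AveragingStep.exists_block {Δ Δ' : Fin n → ℝ} (h : AveragingStep Δ Δ') :
    ∃ j k l : Fin n, j < k ∧ k ≤ l ∧
      (∀ p : Fin n, p.val + 1 = j.val → Δ p ≠ Δ j) ∧
      (∀ p : Fin n, p.val + 1 = k.val → Δ p ≠ Δ k) ∧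
      (∀ p : Fin n, p.val = l.val + 1 → Δ l ≠ Δ p) ∧
      (∀ p q : Fin n, j ≤ p → p ≤ l → j ≤ q → q ≤ l → Δ' p = Δ' q) ∧
      (∀ p : Fin n, j ≤ p → p < k → Δ p ≤ Δ' p) ∧
      (∀ p : Fin n, k ≤ p → p ≤ l → Δ' p ≤ Δ p) ∧
      (∀ p : Fin n, ¬ (j ≤ p ∧ p ≤ l) → Δ' p = Δ p) ∧
      ∑ i, Δ' i = ∑ i, Δ i := by
  obtain ⟨j, k, l, hjk, hkl, a1, a2, a3, a4, a5, a6, a7⟩ := h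
  have hjl : j.val < l.val := Fin.lt_def.1 (hjk.trans_le hkl)
  set m := (∑ q ∈ Finset.Icc j l, Δ q) / ((l.val : ℝ) - (j.val : ℝ) + 1) with hm
  have hcard : (((Finset.Icc j l).card : ℕ) : ℝ) = (l.val : ℝ) - (j.val : ℝ) + 1 := by
    rw [Fin.card_Icc, Nat.cast_sub (by omega)]
    push_cast
    ring
  have hpos : 0 < (l.val : ℝ) - (j.val : ℝ) + 1 := by
    have : (j.val : ℝ) < l.val := by exact_mod_cast hjl
    linarith
  have hbd : ∀ q ∈ Finset.Icc j l, Δ j ≤ Δ q ∧ Δ q ≤ Δ k := by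
    intro q hq
    rw [Finset.mem_Icc] at hq
    rcases lt_or_ge q k with h | h
    · rw [a3 q hq.1 h]; exact ⟨le_rfl, a4.le⟩
    · rw [a5 q h hq.2]; exact ⟨a4.le, le_rfl⟩
  have hmj : Δ j ≤ m := by
    rw [hm, le_div_iff₀ hpos, ← hcard, mul_comm, ← nsmul_eq_mul]
    exact Finset.card_nsmul_le_sum _ _ _ fun q hq => (hbd q hq).1
  have hmk : m ≤ Δ k := by
    rw [hm, div_le_iff₀ hpos, ← hcard, mul_comm, ← nsmul_eq_mul]
    exact Finset.sum_le_card_nsmul _ _ _ fun q hq => (hbd q hq).2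
  have hin : ∀ p, j ≤ p → p ≤ l → Δ' p = m := fun p h1 h2 => by rw [a7, if_pos ⟨h1, h2⟩]
  refine ⟨j, k, l, hjk, hkl, fun p hp => (a2 p hp).ne', fun p hp => ?_, a6, ?_, ?_, ?_, ?_, ?_⟩
  · rw [a3 p (by rw [Fin.le_def]; rw [Fin.lt_def] at hjk; omega) (by rw [Fin.lt_def]; omega)]
    exact a4.ne
  · intro p q h1 h2 h3 h4
    rw [hin p h1 h2, hin q h3 h4]
  · intro p h1 h2
    rw [hin p h1 (h2.le.trans hkl), a3 p h1 h2]
    exact hmj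
  · intro p h1 h2
    rw [hin p (hjk.le.trans h1) h2, a5 p h1 h2]
    exact hmk
  · intro p hp
    rw [a7, if_neg hp]
  · rw [← sub_eq_zero, ← Finset.sum_sub_distrib]
    have e : ∀ i, Δ' i - Δ i = if i ∈ Finset.Icc j l then m - Δ i else 0 := fun i => by
      simp only [a7, Finset.mem_Icc]
      split_ifs <;> simp
    rw [Finset.sum_congr rfl fun i _ => e i, Finset.sum_ite_mem, Finset.univ_inter,
      Finset.sum_sub_distrib, Finset.sum_const, nsmul_eq_mul, hcard, hm]
    field_simp
    ring

theorem prefixSum_eq_of_eqOn {x y : Fin n → ℝ} {k : ℕ} (h : ∀ i : Fin n, i.val < k → x i = y i) :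
    prefixSum x k = prefixSum y k :=
  Finset.sum_congr rfl fun i hi => h i (Finset.mem_filter.1 hi).2

theorem prefixSum_add_sum_ge (x : Fin n → ℝ) (k : ℕ) :
    prefixSum x k + ∑ i with k ≤ i.val, x i = ∑ i, x i := by
  rw [prefixSum, ← Finset.sum_filter_add_sum_filter_not Finset.univ (fun i : Fin n => i.val < k) x]
  simp only [not_lt]

/-- Raising precedes lowering and the total is kept, so prefix sums only grow: compare heads up to
`k` and tails beyond. A change of `Δ'` is at or outside the ends of the block, where `Δ` already
changed and the prefix sum is unaltered. -/
theorem AveragingStep.isTouchingMajorant {Δ₀ Δ Δ' : Fin n → ℝ} (h : AveragingStep Δ Δ')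
    (hΔ : IsTouchingMajorant Δ₀ Δ) : IsTouchingMajorant Δ₀ Δ' := by
  obtain ⟨j, k, l, hjk, hkl, h1, -, h3, h4, h5, h6, h7, h8⟩ := h.exists_block
  rw [Fin.lt_def] at hjk
  rw [Fin.le_def] at hkl
  refine ⟨fun t => (hΔ.prefixSum_le t).trans ?_, h8.trans hΔ.sum_eq, fun p q hpq hne => ?_⟩
  · rcases le_or_gt t k.val with ht | ht
    · refine Finset.sum_le_sum fun i hi => ?_
      have hi := (Finset.mem_filter.1 hi).2
      by_cases hij : j ≤ i
      · exact h5 i hij (by rw [Fin.lt_def]; omega)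
      · exact (h7 i fun h => hij h.1).ge
    · have e1 := prefixSum_add_sum_ge Δ t
      have e2 := prefixSum_add_sum_ge Δ' t
      have : ∑ i with t ≤ i.val, Δ' i ≤ ∑ i with t ≤ i.val, Δ i := by
        refine Finset.sum_le_sum fun i hi => ?_
        have hi := (Finset.mem_filter.1 hi).2
        by_cases hil : i ≤ l
        · exact h6 i (by rw [Fin.le_def]; omega) hil
        · exact (h7 i fun h => hil h.2).le
      linarith
  · have hcase : q ≤ j ∨ l < q := by
      by_contra! hc
      have c1 : j.val < q.val := hc.1
      have c2 : q.val ≤ l.val := hc.2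
      exact hne (h4 p q (by rw [Fin.le_def]; omega) (by rw [Fin.le_def]; omega) hc.1.le hc.2)
    rcases hcase with hq | hq
    · have hq' : q.val ≤ j.val := hq
      have hpj : Δ' p = Δ p := h7 p fun h => by
        have : j.val ≤ p.val := h.1
        omega
      have hne' : Δ p ≠ Δ q := by
        rcases hq.eq_or_lt with rfl | hq2
        · exact h1 p hpq.symm
        · rwa [← hpj, ← h7 q fun h => hq2.not_ge h.1]
      rw [← hΔ.touch p q hpq hne']
      exact prefixSum_eq_of_eqOn fun i hi => h7 i fun h => by
        have : j.val ≤ i.val := h.1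
        omega
    · have hq' : l.val < q.val := hq
      have hqj : Δ' q = Δ q := h7 q fun h => hq.not_ge h.2
      have hne' : Δ p ≠ Δ q := by
        by_cases hpl : p = l
        · rw [hpl]
          exact h3 q (by rw [hpq, hpl])
        · rwa [← hqj, ← h7 p fun h => hpl (Fin.ext (by
            have : p.val ≤ l.val := h.2
            omega))]
      rw [← hΔ.touch p q hpq hne']
      have e1 := prefixSum_add_sum_ge Δ q.val
      have e2 := prefixSum_add_sum_ge Δ' q.val
      have : ∑ i with q.val ≤ i.val, Δ' i = ∑ i with q.val ≤ i.val, Δ i := by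
        refine Finset.sum_congr rfl fun i hi => h7 i fun h => ?_
        have hi := (Finset.mem_filter.1 hi).2
        have : i.val ≤ l.val := h.2
        omega
      linarith

/-- The number of places where `Δ` changes. -/
def numChanges (Δ : Fin n → ℝ) : ℕ :=
  {p : Fin n | ∃ q : Fin n, q.val = p.val + 1 ∧ Δ p ≠ Δ q}.ncard

/-- No change is created, since `Δ` already changes at both ends of the block, and the one at `k`
disappears. -/
theorem AveragingStep.numChanges_lt {Δ Δ' : Fin n → ℝ} (h : AveragingStep Δ Δ') :
    numChanges Δ' < numChanges Δ := by
  obtain ⟨j, k, l, hjk, hkl, h1, h2, h3, h4, h5, h6, h7, h8⟩ := h.exists_block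
  rw [Fin.lt_def] at hjk
  rw [Fin.le_def] at hkl
  refine Set.ncard_lt_ncard ⟨?_, ?_⟩ (Set.toFinite _)
  · rintro p ⟨q, hpq, hne⟩
    refine ⟨q, hpq, ?_⟩
    by_cases hp : j ≤ p ∧ p ≤ l
    · by_cases hq : j ≤ q ∧ q ≤ l
      · exact absurd (h4 p q hp.1 hp.2 hq.1 hq.2) hne
      · have hpl : p = l := by
          rw [Fin.le_def, Fin.le_def] at hp hq
          exact Fin.ext (by omega)
        rw [hpl]
        exact h3 q (by rw [hpq, hpl])
    · by_cases hq : j ≤ q ∧ q ≤ l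
      · have hqj : q = j := by
          rw [Fin.le_def, Fin.le_def] at hp hq
          exact Fin.ext (by omega)
        rw [hqj]
        exact h1 p (by rw [← hpq, hqj])
      · rwa [← h7 p hp, ← h7 q hq]
  · intro hsub
    obtain ⟨p, hp⟩ : ∃ p : Fin n, p.val + 1 = k.val := ⟨⟨k.val - 1, by omega⟩, by dsimp only; omega⟩
    obtain ⟨q, hpq, hne⟩ := hsub ⟨k, hp.symm, h2 p hp⟩
    obtain rfl : q = k := Fin.ext (by omega)
    exact hne (h4 p q (by rw [Fin.le_def]; omega) (by rw [Fin.le_def]; omega)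
      (by rw [Fin.le_def]; omega) (by rw [Fin.le_def]; omega))

theorem wellFounded_averagingStep :
    WellFounded fun Δ' Δ : Fin n → ℝ => AveragingStep Δ Δ' :=
  Subrelation.wf (fun h => AveragingStep.numChanges_lt h) (measure numChanges).wf

theorem existsUnique_averagingStep {Δ : Fin n → ℝ} (h : ¬ Antitone Δ) :
    ∃! Δ', AveragingStep Δ Δ' :=
  (exists_averagingStep h).elim fun Δ' h' => ⟨Δ', h', fun _ h'' => h''.unique h'⟩

theorem AveragingRun.unique {a Δ e e' : Fin n → ℝ} (h : AveragingRun a Δ e)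
    (h' : AveragingRun a Δ e') : e = e' := by
  induction h with
  | halt Δ hΔ =>
    cases h' with
    | halt => rfl
    | step _ _ _ hn => exact absurd hΔ hn
  | step Δ Δ₁ e hn hs _ ih =>
    cases h' with
    | halt _ hΔ => exact absurd hΔ hn
    | step _ Δ₂ _ _ hs' hr' =>
      rw [hs'.unique hs] at hr'
      exact ih hr'

theorem exists_averagingRun (a Δ₀ Δ : Fin n → ℝ) (h : IsTouchingMajorant Δ₀ Δ) :
    ∃ Γ, AveragingRun a Δ (a - Γ) ∧ Antitone Γ ∧ IsTouchingMajorant Δ₀ Γ := by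
  induction Δ using wellFounded_averagingStep.induction with
  | _ Δ ih =>
    by_cases hΔ : Antitone Δ
    · exact ⟨Δ, .halt Δ hΔ, hΔ, h⟩
    · obtain ⟨Δ', hs⟩ := exists_averagingStep hΔ
      obtain ⟨Γ, h1, h2, h3⟩ := ih Δ' hs (hs.isTouchingMajorant h)
      exact ⟨Γ, .step Δ Δ' _ hΔ hs h1, h2, h3⟩

/-- The output of the averaging algorithm, through its final difference vector. -/
theorem exists_averagingOutput (a b : Fin n → ℝ) :
    ∃ Γ, (∀ e, AveragingOutput a b e ↔ e = a - Γ) ∧ Antitone Γ ∧ IsTouchingMajorant (a - b) Γ := by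
  obtain ⟨Γ, h1, h2, h3⟩ := exists_averagingRun a (a - b) (a - b) (.refl _)
  refine ⟨Γ, fun e => ⟨fun h => AveragingRun.unique h h1, ?_⟩, h2, h3⟩
  rintro rfl
  exact h1

/-! ### Properties of the output and minimality of the final difference vector -/

section Output

variable {a b Γ : Fin n → ℝ}

theorem IsTouchingMajorant.prefixSum_sub_le (h : IsTouchingMajorant (a - b) Γ) (k : ℕ) :
    prefixSum (a - Γ) k ≤ prefixSum b k := by
  have := h.prefixSum_le k
  rw [prefixSum_sub] at this ⊢
  linarith

theorem IsTouchingMajorant.sum_sub (h : IsTouchingMajorant (a - b) Γ) :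
    ∑ i, (a - Γ) i = ∑ i, b i := by
  have := h.sum_eq
  simp only [Pi.sub_apply, Finset.sum_sub_distrib] at this ⊢
  linarith

/-- Where `Γ` is constant the descent is that of `a`. Where it changes, the prefix sums of `a - Γ`
touch those of `b` from below, so (a - Γ)ᵢ ≥ bᵢ ≥ bⱼ ≥ (a - Γ)ⱼ. -/
theorem IsTouchingMajorant.antitone_sub (h : IsTouchingMajorant (a - b) Γ) (ha : Antitone a)
    (hb : Antitone b) : Antitone (a - Γ) := by
  refine antitone_of_adjacent_le fun i j hij => ?_
  have hij' : i ≤ j := by rw [Fin.le_def]; omega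
  by_cases hΓ : Γ i = Γ j
  · have := ha hij'
    simp only [Pi.sub_apply]
    linarith
  · have e := h.touch i j hij hΓ
    have e1 := prefixSum_succ (a - Γ) i
    have e2 := prefixSum_succ b i
    have e3 := prefixSum_succ (a - Γ) j
    have e4 := prefixSum_succ b j
    have e5 := h.prefixSum_sub_le i.val
    have e6 := h.prefixSum_sub_le (j.val + 1)
    have e7 := hb hij'
    rw [← hij] at e1 e2
    have e8 : prefixSum (a - Γ) j.val = prefixSum b j.val := by
      rw [prefixSum_sub] at e ⊢
      linarith
    linarith

theorem IsTouchingMajorant.majorized (h : IsTouchingMajorant (a - b) Γ) (ha : Antitone a)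
    (hb : Antitone b) : Majorized (a - Γ) b :=
  .of_prefixSum_le (h.antitone_sub ha hb) h.prefixSum_sub_le h.sum_sub

/-- The last entry is the smallest; as the totals agree and the earlier prefix sum is at most that
of `b`, it is at least the last entry of `b`. -/
theorem IsTouchingMajorant.nonneg (h : IsTouchingMajorant (a - b) Γ) (ha : Antitone a)
    (hb : Antitone b) (hb0 : ∀ i, 0 ≤ b i) (i : Fin n) : 0 ≤ (a - Γ) i := by
  have hn : n - 1 < n := by have := i.2; omega
  set m : Fin n := ⟨n - 1, hn⟩ with hm
  have h1 := prefixSum_succ (a - Γ) m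
  have h2 := prefixSum_succ b m
  rw [prefixSum_of_le _ (by simp only [hm]; omega)] at h1 h2
  have h3 := h.prefixSum_sub_le m.val
  have h4 := h.sum_sub
  have h5 := h.antitone_sub ha hb (show i ≤ m by rw [Fin.le_def]; have := i.2; simp only [hm]; omega)
  linarith [hb0 m]

/-- The final difference vector lies below every antitone vector whose partial sums lie above those
of the initial one. -/
theorem IsTouchingMajorant.prefixSum_le_of_antitone {Δ₀ z : Fin n → ℝ}
    (h : IsTouchingMajorant Δ₀ Γ) (hz : Antitone z) (hle : ∀ k, prefixSum Δ₀ k ≤ prefixSum z k)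
    (hs : ∑ i, z i = ∑ i, Δ₀ i) (k : ℕ) : prefixSum Γ k ≤ prefixSum z k := by
  by_contra! hlt
  have hkn : k < n := by
    by_contra! hn
    rw [prefixSum_of_le _ hn, prefixSum_of_le _ hn, h.sum_eq, hs] at hlt
    exact lt_irrefl _ hlt
  set S : ℕ → ℝ := fun t => prefixSum z t - prefixSum Γ t with hS
  have hS0 : S 0 = 0 := by simp [hS, prefixSum_zero]
  have hSk : S k < 0 := sub_neg.2 hlt
  obtain ⟨t, htmem, htmin⟩ := Finset.exists_min_image (Finset.range (n + 1)) S ⟨0, by simp⟩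
  have hfirst : ∃ t, t < n + 1 ∧ ∀ s < n + 1, S t ≤ S s :=
    ⟨t, Finset.mem_range.1 htmem, fun s hs => htmin s (Finset.mem_range.2 hs)⟩
  classical
  -- At the first minimizer `r` of the gap `S`, the increment of `S` before `r` is negative and the
  -- one after is nonnegative. As `z` descends, `Γ` must change at `r`; but there it touches `Δ₀`,
  -- so the gap cannot be negative.
  set r := Nat.find hfirst with hr
  obtain ⟨hr1, hr2⟩ := Nat.find_spec hfirst
  have hSr : S r < 0 := (hr2 k (by omega)).trans_lt hSk
  have hr0 : r ≠ 0 := fun h0 => by rw [h0, hS0] at hSr; exact lt_irrefl _ hSr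
  have hrn : r ≠ n := fun h0 => by
    rw [h0] at hSr
    simp only [hS, prefixSum_of_le _ le_rfl, h.sum_eq, hs, sub_self, lt_irrefl] at hSr
  have hprev : S r < S (r - 1) := by
    refine lt_of_le_of_ne (hr2 _ (by omega)) fun he => ?_
    exact Nat.find_min hfirst (m := r - 1) (by omega) ⟨by omega, fun s hs => he ▸ hr2 s hs⟩
  have hnext : S r ≤ S (r + 1) := hr2 _ (by omega)
  have e1 := prefixSum_succ z ⟨r - 1, by omega⟩
  have e2 := prefixSum_succ Γ ⟨r - 1, by omega⟩
  have e3 := prefixSum_succ z ⟨r, by omega⟩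
  have e4 := prefixSum_succ Γ ⟨r, by omega⟩
  have hr' : r - 1 + 1 = r := by omega
  simp only [hr'] at e1 e2 e3 e4
  have hzle : z ⟨r, by omega⟩ ≤ z ⟨r - 1, by omega⟩ := hz (Fin.le_def.2 (by dsimp only; omega))
  by_cases hΓ : Γ ⟨r - 1, by omega⟩ = Γ ⟨r, by omega⟩
  · simp only [hS] at hprev hnext
    linarith
  · have e := h.touch ⟨r - 1, by omega⟩ ⟨r, by omega⟩ (by dsimp only; omega) hΓ
    have := hle r
    simp only [hS] at hSr
    dsimp only at e
    linarith

end Output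

end Averaging

theorem Majorized.sum_sq_le_of_antitone_right {n : ℕ} {x y : Fin n → ℝ} (h : Majorized x y)
    (hy : Antitone y) : ∑ i, x i ^ 2 ≤ ∑ i, y i ^ 2 := by
  have h' : Majorized (descSort x) y := by
    refine ⟨fun k h1 h2 => ?_, (sum_descSort x).trans h.2⟩
    rw [sumLargest_of_antitone (descSort_antitone x), ← sumLargest_eq_prefixSum]
    exact h.1 k h1 h2
  refine Eq.trans_le ?_ (h'.sum_sq_le (descSort_antitone x) hy)
  exact (Equiv.sum_comp (Tuple.sort fun i => -x i) fun i => x i ^ 2).symm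

/-! ### Eigenvalues, diagonals and the theorems of Weyl and Lidskii -/

section Spectral

variable {n : ℕ}

theorem realDiag_add (x y : Fin n → ℝ) : realDiag (x + y) = realDiag x + realDiag y := by
  simp [realDiag, Matrix.diagonal_add]

theorem realDiag_sub (x y : Fin n → ℝ) : realDiag (x - y) = realDiag x - realDiag y := by
  simp [realDiag, Matrix.diagonal_sub]

theorem realDiag_apply_self (x : Fin n → ℝ) (i : Fin n) : realDiag x i i = (x i : ℂ) := by
  simp [realDiag]

theorem isHermitian_realDiag (x : Fin n → ℝ) : (realDiag x).IsHermitian := by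
  simp [realDiag, Matrix.IsHermitian, Matrix.diagonal_conjTranspose, Pi.star_def]

theorem conjTranspose_mul_self_of_mem {V : Matrix (Fin n) (Fin n) ℂ}
    (hV : V ∈ Matrix.unitaryGroup (Fin n) ℂ) : Vᴴ * V = 1 :=
  Matrix.mem_unitaryGroup_iff'.1 hV

theorem mul_conjTranspose_self_of_mem {V : Matrix (Fin n) (Fin n) ℂ}
    (hV : V ∈ Matrix.unitaryGroup (Fin n) ℂ) : V * Vᴴ = 1 :=
  Matrix.mem_unitaryGroup_iff.1 hV

theorem conjTranspose_mem {V : Matrix (Fin n) (Fin n) ℂ}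
    (hV : V ∈ Matrix.unitaryGroup (Fin n) ℂ) : Vᴴ ∈ Matrix.unitaryGroup (Fin n) ℂ :=
  Unitary.star_mem hV

theorem eq_conj_of_conj_eq {V X D : Matrix (Fin n) (Fin n) ℂ}
    (hV : V ∈ Matrix.unitaryGroup (Fin n) ℂ) (h : V * X * Vᴴ = D) : X = Vᴴ * D * V := by
  have h1 := conjTranspose_mul_self_of_mem hV
  calc X = (Vᴴ * V) * X * (Vᴴ * V) := by rw [h1, one_mul, mul_one]
    _ = Vᴴ * D * V := by rw [← h]; simp only [Matrix.mul_assoc]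

theorem conj_eq_of_eq_conj {V X D : Matrix (Fin n) (Fin n) ℂ}
    (hV : V ∈ Matrix.unitaryGroup (Fin n) ℂ) (h : X = Vᴴ * D * V) : V * X * Vᴴ = D := by
  have h1 := mul_conjTranspose_self_of_mem hV
  calc V * X * Vᴴ = (V * Vᴴ) * D * (V * Vᴴ) := by rw [h]; simp only [Matrix.mul_assoc]
    _ = D := by rw [h1, one_mul, mul_one]

theorem submatrix_mem_unitaryGroup {V : Matrix (Fin n) (Fin n) ℂ}
    (hV : V ∈ Matrix.unitaryGroup (Fin n) ℂ) (π : Equiv.Perm (Fin n)) :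
    V.submatrix π id ∈ Matrix.unitaryGroup (Fin n) ℂ := by
  rw [Matrix.mem_unitaryGroup_iff, Matrix.star_eq_conjTranspose, Matrix.conjTranspose_submatrix]
  have := Matrix.submatrix_mul V Vᴴ π id π Function.bijective_id
  rw [← this, mul_conjTranspose_self_of_mem hV, Matrix.submatrix_one_equiv]

theorem submatrix_conj_eq_realDiag {V X : Matrix (Fin n) (Fin n) ℂ} {x : Fin n → ℝ}
    (h : V * X * Vᴴ = realDiag x) (π : Equiv.Perm (Fin n)) :
    V.submatrix π id * X * (V.submatrix π id)ᴴ = realDiag (x ∘ π) := by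
  have e : V.submatrix π id * X * (V.submatrix π id)ᴴ = (V * X * Vᴴ).submatrix π π := by
    ext i j
    simp [Matrix.mul_apply]
  rw [e, h, realDiag, realDiag, Matrix.submatrix_diagonal_equiv]
  rfl

theorem eigVec_antitone {X : Matrix (Fin n) (Fin n) ℂ} (hX : X.IsHermitian) :
    Antitone (eigVec hX) :=
  fun _ _ hij => hX.eigenvalues₀_antitone hij

theorem exists_conj_eq_eigVec {X : Matrix (Fin n) (Fin n) ℂ} (hX : X.IsHermitian) :
    ∃ V ∈ Matrix.unitaryGroup (Fin n) ℂ, V * X * Vᴴ = realDiag (eigVec hX) := by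
  -- `eigenvalues` reads the sorted list through an arbitrary equivalence of index types; permuting
  -- the rows of the diagonalizing unitary undoes it.
  set e : Fin n ≃ Fin n :=
    (Fintype.equivOfCardEq (Fintype.card_fin _)).symm.trans (finCongr (Fintype.card_fin n)) with he
  have h1 : hX.eigenvalues = eigVec hX ∘ e := rfl
  set U : Matrix (Fin n) (Fin n) ℂ := hX.eigenvectorUnitary.1 with hU
  have hUmem : U ∈ Matrix.unitaryGroup (Fin n) ℂ := hX.eigenvectorUnitary.2
  have h2 : Uᴴ * X * Uᴴᴴ = realDiag hX.eigenvalues := by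
    have := hX.conjStarAlgAut_star_eigenvectorUnitary
    rw [Unitary.conjStarAlgAut_star_apply] at this
    rw [Matrix.conjTranspose_conjTranspose]
    exact this
  refine ⟨Uᴴ.submatrix e.symm id, submatrix_mem_unitaryGroup (conjTranspose_mem hUmem) _, ?_⟩
  rw [submatrix_conj_eq_realDiag h2, h1]
  congr 1
  ext i
  simp

/-- The real parts of the diagonal entries. -/
def reDiag (X : Matrix (Fin n) (Fin n) ℂ) : Fin n → ℝ :=
  fun i => (X i i).re

theorem reDiag_realDiag (x : Fin n → ℝ) : reDiag (realDiag x) = x := by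
  ext i
  simp [reDiag, realDiag_apply_self]

theorem reDiag_add (X Y : Matrix (Fin n) (Fin n) ℂ) : reDiag (X + Y) = reDiag X + reDiag Y := by
  ext i
  simp [reDiag]

theorem mul_realDiag_mul_conjTranspose_apply_self (F : Matrix (Fin n) (Fin n) ℂ) (x : Fin n → ℝ)
    (i : Fin n) :
    (F * realDiag x * Fᴴ) i i = ((∑ j, Complex.normSq (F i j) * x j : ℝ) : ℂ) := by
  rw [Matrix.mul_apply]
  push_cast
  refine Finset.sum_congr rfl fun j _ => ?_
  rw [realDiag, Matrix.mul_diagonal, Matrix.conjTranspose_apply, ← Complex.mul_conj]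
  simp only [RCLike.star_def]
  ring

theorem mul_conjTranspose_apply_self (F : Matrix (Fin n) (Fin n) ℂ) (i : Fin n) :
    (F * Fᴴ) i i = ((∑ j, Complex.normSq (F i j) : ℝ) : ℂ) := by
  rw [Matrix.mul_apply]
  push_cast
  refine Finset.sum_congr rfl fun j _ => ?_
  rw [Matrix.conjTranspose_apply, ← Complex.mul_conj]
  rfl

/-- The averaging matrix has entries ∑ᵣ |Fᵣ(i, j)|². Its row sums are 1 by `h1` (unitality), its
column sums by `h2` (trace preservation). -/
theorem isAverage_reDiag_sum {ι : Type*} [Fintype ι] {F : ι → Matrix (Fin n) (Fin n) ℂ}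
    (h1 : ∑ r, F r * (F r)ᴴ = 1) (h2 : ∑ r, (F r)ᴴ * F r = 1) (x : Fin n → ℝ) :
    IsAverage (reDiag (∑ r, F r * realDiag x * (F r)ᴴ)) x := by
  refine ⟨Matrix.of fun i j => ∑ r, Complex.normSq (F r i j), ?_, ?_⟩
  · rw [mem_doublyStochastic_iff_sum]
    refine ⟨fun i j => Finset.sum_nonneg fun r _ => Complex.normSq_nonneg _, fun i => ?_,
      fun j => ?_⟩
    · have := congrFun (congrFun h1 i) i
      rw [Matrix.sum_apply] at this
      simp only [mul_conjTranspose_apply_self, Matrix.one_apply_eq] at this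
      simp only [Matrix.of_apply]
      rw [Finset.sum_comm]
      exact_mod_cast this
    · have := congrFun (congrFun h2 j) j
      rw [Matrix.sum_apply] at this
      have e : ∀ r, ((F r)ᴴ * F r) j j = ((∑ i, Complex.normSq (F r i j) : ℝ) : ℂ) := fun r => by
        have := mul_conjTranspose_apply_self (F r)ᴴ j
        rw [Matrix.conjTranspose_conjTranspose] at this
        rw [this]
        simp [Matrix.conjTranspose_apply]
      simp only [e, Matrix.one_apply_eq] at this
      simp only [Matrix.of_apply]
      rw [Finset.sum_comm]
      exact_mod_cast this
  · ext i
    simp only [reDiag, Matrix.sum_apply, mul_realDiag_mul_conjTranspose_apply_self, Matrix.mulVec,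
      dotProduct, Matrix.of_apply, Complex.re_sum, Complex.ofReal_re]
    rw [Finset.sum_comm]
    simp only [Finset.sum_mul]

theorem isAverage_reDiag_conj {V : Matrix (Fin n) (Fin n) ℂ}
    (hV : V ∈ Matrix.unitaryGroup (Fin n) ℂ) (x : Fin n → ℝ) :
    IsAverage (reDiag (V * realDiag x * Vᴴ)) x := by
  have := isAverage_reDiag_sum (F := fun _ : Unit => V)
    (by simpa using mul_conjTranspose_self_of_mem hV)
    (by simpa using conjTranspose_mul_self_of_mem hV) x
  simpa using this

theorem isAverage_of_conj_eq {V W X : Matrix (Fin n) (Fin n) ℂ} {x : Fin n → ℝ}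
    (hV : V ∈ Matrix.unitaryGroup (Fin n) ℂ) (hW : W ∈ Matrix.unitaryGroup (Fin n) ℂ)
    (hx : V * X * Vᴴ = realDiag x) : IsAverage (reDiag (W * X * Wᴴ)) x := by
  have := isAverage_reDiag_conj (mul_mem hW (conjTranspose_mem hV)) x
  rw [eq_conj_of_conj_eq hV hx]
  rw [Matrix.conjTranspose_mul, Matrix.conjTranspose_conjTranspose] at this
  simpa only [Matrix.mul_assoc] using this

/-- The diagonals of two unitary diagonalizations are averages of each other, so they agree once
sorted. -/
theorem eigVec_eq_of_conj {X V : Matrix (Fin n) (Fin n) ℂ} {x : Fin n → ℝ} (hX : X.IsHermitian)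
    (hV : V ∈ Matrix.unitaryGroup (Fin n) ℂ) (h : V * X * Vᴴ = realDiag x) (hx : Antitone x) :
    eigVec hX = x := by
  obtain ⟨W, hW, hWX⟩ := exists_conj_eq_eigVec hX
  have h1 := isAverage_of_conj_eq hV hW h
  have h2 := isAverage_of_conj_eq hW hV hWX
  rw [hWX, reDiag_realDiag] at h1
  rw [h, reDiag_realDiag] at h2
  exact h1.eq_of_antitone h2 (eigVec_antitone hX) hx

theorem isAverage_reDiag_eigVec {X W : Matrix (Fin n) (Fin n) ℂ} (hX : X.IsHermitian)
    (hW : W ∈ Matrix.unitaryGroup (Fin n) ℂ) : IsAverage (reDiag (W * X * Wᴴ)) (eigVec hX) := by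
  obtain ⟨V, hV, hVX⟩ := exists_conj_eq_eigVec hX
  exact isAverage_of_conj_eq hV hW hVX

/-- The squared Frobenius norm. -/
def frobSq (X : Matrix (Fin n) (Fin n) ℂ) : ℝ :=
  ∑ i, ∑ j, Complex.normSq (X i j)

theorem ofReal_frobSq (X : Matrix (Fin n) (Fin n) ℂ) : (frobSq X : ℂ) = (X * Xᴴ).trace := by
  simp only [Matrix.trace, Matrix.diag_apply, mul_conjTranspose_apply_self, frobSq]
  push_cast
  rfl

theorem frobSq_conj (X : Matrix (Fin n) (Fin n) ℂ) {V : Matrix (Fin n) (Fin n) ℂ}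
    (hV : V ∈ Matrix.unitaryGroup (Fin n) ℂ) : frobSq (V * X * Vᴴ) = frobSq X := by
  apply Complex.ofReal_injective
  rw [ofReal_frobSq, ofReal_frobSq]
  have h1 := conjTranspose_mul_self_of_mem hV
  have : V * X * Vᴴ * (V * X * Vᴴ)ᴴ = V * (X * Xᴴ) * Vᴴ := by
    simp only [Matrix.conjTranspose_mul, Matrix.conjTranspose_conjTranspose]
    calc V * X * Vᴴ * (V * (Xᴴ * Vᴴ)) = V * X * (Vᴴ * V) * (Xᴴ * Vᴴ) := by
          simp only [Matrix.mul_assoc]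
      _ = V * (X * Xᴴ) * Vᴴ := by rw [h1, mul_one]; simp only [Matrix.mul_assoc]
  rw [this, Matrix.trace_mul_comm, ← Matrix.mul_assoc, h1, one_mul]

theorem frobSq_realDiag (x : Fin n → ℝ) : frobSq (realDiag x) = ∑ i, x i ^ 2 := by
  refine Finset.sum_congr rfl fun i _ => ?_
  rw [Finset.sum_eq_single i]
  · simp [realDiag_apply_self, Complex.normSq_ofReal, sq]
  · intro j _ hj
    simp [realDiag, Matrix.diagonal_apply_ne' _ hj]
  · simp

theorem frobSq_eq_sum_eigVec {X : Matrix (Fin n) (Fin n) ℂ} (hX : X.IsHermitian) :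
    frobSq X = ∑ i, eigVec hX i ^ 2 := by
  obtain ⟨V, hV, hVX⟩ := exists_conj_eq_eigVec hX
  rw [← frobSq_conj X hV, hVX, frobSq_realDiag]

/-- The diagonal already exhausts the Frobenius norm. -/
theorem eq_realDiag_of_frobSq_le {X : Matrix (Fin n) (Fin n) ℂ} (hX : X.IsHermitian)
    (h : frobSq X ≤ ∑ i, reDiag X i ^ 2) : X = realDiag (reDiag X) := by
  have hdiag : ∀ i, ((reDiag X i : ℝ) : ℂ) = X i i := fun i => hX.coe_re_apply_self i
  have hsq : ∀ i, Complex.normSq (X i i) = reDiag X i ^ 2 := fun i => by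
    rw [← hdiag i, Complex.normSq_ofReal, sq]
  have hle : ∀ i, reDiag X i ^ 2 ≤ ∑ j, Complex.normSq (X i j) := fun i => by
    rw [← hsq i]
    exact Finset.single_le_sum (f := fun j => Complex.normSq (X i j))
      (fun j _ => Complex.normSq_nonneg _) (Finset.mem_univ i)
  have heq : ∀ i ∈ Finset.univ, reDiag X i ^ 2 = ∑ j, Complex.normSq (X i j) :=
    (Finset.sum_eq_sum_iff_of_le fun i _ => hle i).1
      (le_antisymm (Finset.sum_le_sum fun i _ => hle i) h)
  ext i j
  rcases eq_or_ne i j with rfl | hij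
  · rw [realDiag_apply_self, hdiag]
  · have h1 := heq i (Finset.mem_univ i)
    rw [← Finset.add_sum_erase _ _ (Finset.mem_univ i), hsq i] at h1
    have h2 : ∑ x ∈ Finset.univ.erase i, Complex.normSq (X i x) = 0 := by linarith
    rw [Finset.sum_eq_zero_iff_of_nonneg fun j _ => Complex.normSq_nonneg _] at h2
    have h3 := h2 j (Finset.mem_erase.2 ⟨hij.symm, Finset.mem_univ j⟩)
    rw [Complex.normSq_eq_zero.1 h3, realDiag, Matrix.diagonal_apply_ne _ hij]

/-- The equality case of Ky Fan's inequality for the eigenvalues of a sum. -/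
theorem conj_eq_realDiag_of_add {Y Z V : Matrix (Fin n) (Fin n) ℂ} {y z : Fin n → ℝ}
    (hY : Y.IsHermitian) (hZ : Z.IsHermitian) (hV : V ∈ Matrix.unitaryGroup (Fin n) ℂ)
    (h : V * (Y + Z) * Vᴴ = realDiag (y + z))
    (hy : ∀ k, prefixSum (reDiag (V * Y * Vᴴ)) k ≤ prefixSum y k)
    (hz : ∀ k, prefixSum (reDiag (V * Z * Vᴴ)) k ≤ prefixSum z k)
    (hy2 : frobSq Y ≤ ∑ i, y i ^ 2) (hz2 : frobSq Z ≤ ∑ i, z i ^ 2) :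
    V * Y * Vᴴ = realDiag y ∧ V * Z * Vᴴ = realDiag z := by
  have hsum : reDiag (V * Y * Vᴴ) + reDiag (V * Z * Vᴴ) = y + z := by
    rw [← reDiag_add, ← add_mul, ← mul_add, h, reDiag_realDiag]
  have hk : ∀ k, prefixSum (reDiag (V * Y * Vᴴ)) k + prefixSum (reDiag (V * Z * Vᴴ)) k =
      prefixSum y k + prefixSum z k := fun k => by
    rw [← prefixSum_add, hsum, prefixSum_add]
  -- The bounds `hy` and `hz` add up to an equality, so each is an equality.
  have ey : reDiag (V * Y * Vᴴ) = y := prefixSum_injective fun k => by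
    linarith [hk k, hy k, hz k]
  have ez : reDiag (V * Z * Vᴴ) = z := prefixSum_injective fun k => by
    linarith [hk k, hy k, hz k]
  have h1 := eq_realDiag_of_frobSq_le (Matrix.isHermitian_mul_mul_conjTranspose V hY)
    (by rw [frobSq_conj Y hV, ey]; exact hy2)
  have h2 := eq_realDiag_of_frobSq_le (Matrix.isHermitian_mul_mul_conjTranspose V hZ)
    (by rw [frobSq_conj Z hV, ez]; exact hz2)
  rw [ey] at h1
  rw [ez] at h2
  exact ⟨h1, h2⟩

theorem star_dotProduct_mulVec_of_conj {X V : Matrix (Fin n) (Fin n) ℂ} {x : Fin n → ℝ}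
    (hV : V ∈ Matrix.unitaryGroup (Fin n) ℂ) (h : V * X * Vᴴ = realDiag x) (u : Fin n → ℂ) :
    star u ⬝ᵥ X *ᵥ u = ((∑ j, x j * Complex.normSq ((V *ᵥ u) j) : ℝ) : ℂ) := by
  rw [eq_conj_of_conj_eq hV h, ← Matrix.mulVec_mulVec, ← Matrix.mulVec_mulVec,
    Matrix.dotProduct_mulVec, ← Matrix.star_mulVec, realDiag, dotProduct]
  push_cast
  refine Finset.sum_congr rfl fun j _ => ?_
  rw [Matrix.mulVec_diagonal, ← Complex.mul_conj, Pi.star_apply]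
  simp only [RCLike.star_def]
  ring

/-- Weyl's monotonicity theorem. -/
theorem eigVec_le_of_posSemidef_sub {A B : Matrix (Fin n) (Fin n) ℂ} (hA : A.IsHermitian)
    (hB : B.IsHermitian) (h : (B - A).PosSemidef) (i : Fin n) : eigVec hA i ≤ eigVec hB i := by
  obtain ⟨V, hV, hVA⟩ := exists_conj_eq_eigVec hA
  obtain ⟨W, hW, hWB⟩ := exists_conj_eq_eigVec hB
  by_contra! hlt
  -- Only `n - 1` linear conditions, so some `u ≠ 0` has no component before `i` in the eigenbasis
  -- of `B` and none after `i` in that of `A`. The form of `A` at `u` is then at least λᵢ(A)‖u‖²,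
  -- that of `B` at most λᵢ(B)‖u‖².
  set L : (Fin n → ℂ) →ₗ[ℂ] ({j : Fin n // j ≠ i} → ℂ) :=
    LinearMap.pi fun j => if j.1 < i then LinearMap.proj j.1 ∘ₗ W.mulVecLin
      else LinearMap.proj j.1 ∘ₗ V.mulVecLin with hL
  obtain ⟨u, hu, hu0⟩ : ∃ u, L u = 0 ∧ u ≠ 0 := by
    have hnot : ¬ Function.Injective L := fun hinj => by
      have := LinearMap.finrank_le_finrank_of_injective hinj
      simp only [Module.finrank_fintype_fun_eq_card, Fintype.card_fin,
        Fintype.card_subtype_compl, Fintype.card_unique] at this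
      have := i.2
      omega
    rw [← LinearMap.ker_eq_bot, Submodule.eq_bot_iff] at hnot
    push Not at hnot
    obtain ⟨u, hu, hu0⟩ := hnot
    exact ⟨u, LinearMap.mem_ker.1 hu, hu0⟩
  have hWu : ∀ j, j < i → (W *ᵥ u) j = 0 := fun j hj => by
    have := congrFun hu ⟨j, hj.ne⟩
    simpa [hL, hj] using this
  have hVu : ∀ j, i < j → (V *ᵥ u) j = 0 := fun j hj => by
    have := congrFun hu ⟨j, hj.ne'⟩
    simpa [hL, hj.not_gt] using this
  have hone : ∀ U ∈ Matrix.unitaryGroup (Fin n) ℂ,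
      star u ⬝ᵥ u = ((∑ j, Complex.normSq ((U *ᵥ u) j) : ℝ) : ℂ) := fun U hU => by
    have := star_dotProduct_mulVec_of_conj (X := 1) (x := fun _ => 1) hU (by
      rw [mul_one, mul_conjTranspose_self_of_mem hU]
      simp [realDiag]) u
    simpa using this
  have hpos : 0 < ∑ j, Complex.normSq (u j) := by
    refine lt_of_le_of_ne (Finset.sum_nonneg fun j _ => Complex.normSq_nonneg _) fun h0 => hu0 ?_
    have h0 := (Finset.sum_eq_zero_iff_of_nonneg fun j _ => Complex.normSq_nonneg _).1 h0.symm
    ext j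
    exact Complex.normSq_eq_zero.1 (h0 j (Finset.mem_univ j))
  have e1 : ∑ j, Complex.normSq ((V *ᵥ u) j) = ∑ j, Complex.normSq (u j) := by
    have := (hone V hV).symm.trans (hone 1 (one_mem _))
    rw [Matrix.one_mulVec] at this
    exact_mod_cast this
  have e2 : ∑ j, Complex.normSq ((W *ᵥ u) j) = ∑ j, Complex.normSq (u j) := by
    have := (hone W hW).symm.trans (hone 1 (one_mem _))
    rw [Matrix.one_mulVec] at this
    exact_mod_cast this
  have h1 : eigVec hA i * ∑ j, Complex.normSq (u j) ≤
      ∑ j, eigVec hA j * Complex.normSq ((V *ᵥ u) j) := by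
    rw [← e1, Finset.mul_sum]
    refine Finset.sum_le_sum fun j _ => ?_
    rcases le_or_gt j i with hj | hj
    · exact mul_le_mul_of_nonneg_right (eigVec_antitone hA hj) (Complex.normSq_nonneg _)
    · simp [hVu j hj]
  have h2 : ∑ j, eigVec hB j * Complex.normSq ((W *ᵥ u) j) ≤
      eigVec hB i * ∑ j, Complex.normSq (u j) := by
    rw [← e2, Finset.mul_sum]
    refine Finset.sum_le_sum fun j _ => ?_
    rcases lt_or_ge j i with hj | hj
    · simp [hWu j hj]
    · exact mul_le_mul_of_nonneg_right (eigVec_antitone hB hj) (Complex.normSq_nonneg _)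
  have h3 := h.dotProduct_mulVec_nonneg u
  rw [Matrix.sub_mulVec, dotProduct_sub, star_dotProduct_mulVec_of_conj hV hVA,
    star_dotProduct_mulVec_of_conj hW hWB, ← Complex.ofReal_sub, Complex.zero_le_real] at h3
  have := mul_lt_mul_of_pos_right hlt hpos
  linarith

theorem sum_eigVec {X : Matrix (Fin n) (Fin n) ℂ} (hX : X.IsHermitian) :
    ((∑ i, eigVec hX i : ℝ) : ℂ) = X.trace := by
  obtain ⟨V, hV, hVX⟩ := exists_conj_eq_eigVec hX
  have h : (V * X * Vᴴ).trace = X.trace := by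
    rw [Matrix.trace_mul_comm, ← Matrix.mul_assoc, conjTranspose_mul_self_of_mem hV, one_mul]
  rw [← h, hVX, realDiag, Matrix.trace_diagonal]
  push_cast
  rfl

theorem posSemidef_conj_realDiag {V : Matrix (Fin n) (Fin n) ℂ} {x : Fin n → ℝ}
    (hx : ∀ i, 0 ≤ x i) : (Vᴴ * realDiag x * V).PosSemidef := by
  have : (realDiag x).PosSemidef :=
    Matrix.PosSemidef.diagonal fun i => Complex.zero_le_real.2 (hx i)
  exact this.conjTranspose_mul_mul_same V

theorem realDiag_const (t : ℝ) : realDiag (fun _ : Fin n => t) = (t : ℂ) • 1 := by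
  rw [realDiag, Matrix.smul_one_eq_diagonal]

/-- Lidskii's theorem. -/
theorem majorized_eigVec_sub {A B : Matrix (Fin n) (Fin n) ℂ} (hA : A.IsHermitian)
    (hB : B.IsHermitian) (hC : (A - B).IsHermitian) :
    Majorized (eigVec hA - eigVec hB) (eigVec hC) := by
  refine ⟨fun k hk1 hkn => ?_, ?_⟩
  swap
  · apply Complex.ofReal_injective
    rw [sum_eigVec hC, Matrix.trace_sub, ← sum_eigVec hA, ← sum_eigVec hB, ← Complex.ofReal_sub,
      ← Finset.sum_sub_distrib]
    rfl
  rw [sumLargest_of_antitone (eigVec_antitone hC)]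
  obtain ⟨V, hV, hVC⟩ := exists_conj_eq_eigVec hC
  obtain ⟨W, hW, hWB⟩ := exists_conj_eq_eigVec hB
  set c := eigVec hC with hc
  set t := c ⟨k, hkn⟩ with ht
  -- With `t` the `(k + 1)`-st largest eigenvalue of `A - B`, raise all its eigenvalues below `t` to
  -- `t`. The resulting matrix, added to `B`, dominates both `A` and `B + t`, and its trace involves
  -- only the `k` largest eigenvalues and `t`.
  have hH : (B + Vᴴ * realDiag (fun i => max (c i) t) * V).IsHermitian :=
    hB.add (by
      have := Matrix.isHermitian_conjTranspose_mul_mul V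
        (isHermitian_realDiag fun i => max (c i) t)
      exact this)
  have h1 : ∀ i, eigVec hA i ≤ eigVec hH i := by
    refine eigVec_le_of_posSemidef_sub hA hH ?_
    have : B + Vᴴ * realDiag (fun i => max (c i) t) * V - A =
        Vᴴ * realDiag (fun i => max (c i) t - c i) * V := by
      have e := realDiag_sub (fun i => max (c i) t) c
      have e' : ((fun i => max (c i) t) - c) = fun i => max (c i) t - c i := rfl
      rw [e'] at e
      rw [e, mul_sub, sub_mul, ← eq_conj_of_conj_eq hV hVC]
      abel
    rw [this]
    exact posSemidef_conj_realDiag fun i => sub_nonneg.2 (le_max_left _ _)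
  have hBt : (B + (t : ℂ) • 1).IsHermitian := by
    rw [← realDiag_const]
    exact hB.add (isHermitian_realDiag _)
  have hBt_eig : eigVec hBt = fun i => eigVec hB i + t := by
    refine eigVec_eq_of_conj hBt hW ?_ fun i j hij => by
      have := eigVec_antitone hB hij
      linarith
    have e := realDiag_add (eigVec hB) fun _ => t
    have e' : (eigVec hB + fun _ => t) = fun i => eigVec hB i + t := rfl
    rw [e'] at e
    rw [e, realDiag_const, ← hWB, mul_add, add_mul, mul_smul_comm, mul_one, smul_mul_assoc,
      mul_conjTranspose_self_of_mem hW]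
  have h2 : ∀ i, eigVec hB i + t ≤ eigVec hH i := by
    intro i
    have := eigVec_le_of_posSemidef_sub hBt hH (by
      have : B + Vᴴ * realDiag (fun i => max (c i) t) * V - (B + (t : ℂ) • 1) =
          Vᴴ * realDiag (fun i => max (c i) t - t) * V := by
        have e := realDiag_sub (fun i => max (c i) t) fun _ => t
        have e' : ((fun i => max (c i) t) - fun _ => t) = fun i => max (c i) t - t := rfl
        rw [e'] at e
        rw [e, mul_sub, sub_mul, realDiag_const, mul_smul_comm, mul_one, smul_mul_assoc,
          conjTranspose_mul_self_of_mem hV]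
        abel
      rw [this]
      exact posSemidef_conj_realDiag fun i => sub_nonneg.2 (le_max_right _ _)) i
    rwa [hBt_eig] at this
  have h3 : ∑ i, eigVec hH i = ∑ i, eigVec hB i + ∑ i, max (c i) t := by
    apply Complex.ofReal_injective
    rw [sum_eigVec hH, Complex.ofReal_add, sum_eigVec hB, Matrix.trace_add,
      Matrix.trace_mul_comm, ← Matrix.mul_assoc, mul_conjTranspose_self_of_mem hV, one_mul,
      realDiag, Matrix.trace_diagonal]
    push_cast
    rfl
  have h4 : ∑ i, max (c i) t = prefixSum c k + (n - k) * t := by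
    have e : ∀ i : Fin n, max (c i) t = (if i.val < k then c i - t else 0) + t := fun i => by
      split_ifs with hi
      · rw [max_eq_left (eigVec_antitone hC (Fin.le_def.2 hi.le))]
        ring
      · rw [max_eq_right (eigVec_antitone hC (Fin.le_def.2 (not_lt.1 hi)))]
        ring
    rw [Finset.sum_congr rfl fun i _ => e i, Finset.sum_add_distrib, ← Finset.sum_filter,
      Finset.sum_sub_distrib, Finset.sum_const, Finset.sum_const, prefixSum,
      Fin.card_filter_val_lt, min_eq_right hkn.le, Finset.card_univ, Fintype.card_fin]
    simp only [nsmul_eq_mul]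
    ring
  obtain ⟨w, hw0, hw1, hws, hwz⟩ := exists_sumLargest_eq (eigVec hA - eigVec hB) hkn.le
  rw [← hwz]
  -- Replace `A` by the dominating matrix; the remaining bracket is nonnegative by `h2`, so its
  -- weight can be raised to 1 and the sum becomes a trace.
  have h5 : ∀ i, w i * (eigVec hA - eigVec hB) i ≤ (eigVec hH i - eigVec hB i - t) + w i * t :=
    fun i => by
      have a1 := mul_le_mul_of_nonneg_left (h1 i) (hw0 i)
      have a2 := mul_le_mul_of_nonneg_right (hw1 i) (sub_nonneg.2 (h2 i))
      simp only [Pi.sub_apply]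
      linarith
  refine (Finset.sum_le_sum fun i _ => h5 i).trans_eq ?_
  rw [Finset.sum_add_distrib, ← Finset.sum_mul, hws, Finset.sum_sub_distrib,
    Finset.sum_sub_distrib, h3, h4, Finset.sum_const, Finset.card_univ, Fintype.card_fin,
    nsmul_eq_mul]
  ring

end Spectral

/-! ### Mixed unitary and unital channels -/

variable {n : ℕ}

/-- The linear map with the given operator sum representation. -/
def operatorSumMap {ι : Type*} [Fintype ι] (F : ι → Matrix (Fin n) (Fin n) ℂ) :
    Matrix (Fin n) (Fin n) ℂ →ₗ[ℂ] Matrix (Fin n) (Fin n) ℂ where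
  toFun X := ∑ j, F j * X * (F j)ᴴ
  map_add' X Y := by simp only [mul_add, add_mul, Finset.sum_add_distrib]
  map_smul' c X := by simp only [mul_smul_comm, smul_mul_assoc, Finset.smul_sum, RingHom.id_apply]

theorem operatorSumMap_apply {ι : Type*} [Fintype ι] (F : ι → Matrix (Fin n) (Fin n) ℂ)
    (X : Matrix (Fin n) (Fin n) ℂ) : operatorSumMap F X = ∑ j, F j * X * (F j)ᴴ := rfl

theorem smul_mul_mul_conjTranspose_smul (c : ℂ) (U X : Matrix (Fin n) (Fin n) ℂ) :
    (c • U) * X * (c • U)ᴴ = (Complex.normSq c : ℂ) • (U * X * Uᴴ) := by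
  rw [Matrix.conjTranspose_smul, smul_mul_assoc, smul_mul_assoc, mul_smul_comm, smul_smul,
    ← Complex.mul_conj]
  rfl

theorem conjTranspose_smul_mul_smul (c : ℂ) (U : Matrix (Fin n) (Fin n) ℂ) :
    (c • U)ᴴ * (c • U) = (Complex.normSq c : ℂ) • (Uᴴ * U) := by
  rw [Matrix.conjTranspose_smul, smul_mul_assoc, mul_smul_comm, smul_smul, mul_comm,
    ← Complex.mul_conj]
  rfl

/-- A convex combination of unitary conjugations is a mixed unitary channel. -/
theorem exists_isMixedUnitary {ι : Type*} [Fintype ι] {w : ι → ℝ} (h0 : ∀ r, 0 ≤ w r)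
    (h1 : ∑ r, w r = 1) {U : ι → Matrix (Fin n) (Fin n) ℂ}
    (hU : ∀ r, U r ∈ Matrix.unitaryGroup (Fin n) ℂ) :
    ∃ Φ : QuantumChannel n, Φ.IsMixedUnitary ∧
      ∀ X, Φ.toMap X = ∑ r, (w r : ℂ) • (U r * X * (U r)ᴴ) := by
  set e := Fintype.equivFin ι
  have hsq : ∀ r, Complex.normSq ((√(w r) : ℝ) : ℂ) = w r := fun r => by
    rw [Complex.normSq_ofReal, Real.mul_self_sqrt (h0 r)]
  set F : Fin (Fintype.card ι) → Matrix (Fin n) (Fin n) ℂ :=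
    fun j => ((√(w (e.symm j)) : ℝ) : ℂ) • U (e.symm j) with hF
  have hop : IsOperatorSum (operatorSumMap F) F := by
    refine ⟨fun X => rfl, ?_⟩
    simp only [hF, conjTranspose_smul_mul_smul, hsq, conjTranspose_mul_self_of_mem (hU _)]
    rw [Equiv.sum_comp e.symm fun r => (w r : ℂ) • (1 : Matrix (Fin n) (Fin n) ℂ),
      ← Finset.sum_smul, ← Complex.ofReal_sum, h1, Complex.ofReal_one, one_smul]
  refine ⟨⟨operatorSumMap F, _, F, hop⟩, ⟨_, F, hop, fun j => ⟨_, _, hU _, rfl⟩⟩, fun X => ?_⟩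
  refine (operatorSumMap_apply F X).trans ?_
  simp only [hF, smul_mul_mul_conjTranspose_smul, hsq]
  exact Equiv.sum_comp e.symm fun r => (w r : ℂ) • (U r * X * (U r)ᴴ)

theorem QuantumChannel.IsMixedUnitary.isUnital {Φ : QuantumChannel n} (h : Φ.IsMixedUnitary) :
    Φ.IsUnital := by
  obtain ⟨r, F, ⟨hF, hI⟩, hU⟩ := h
  refine (hF 1).trans (Eq.trans ?_ hI)
  refine Finset.sum_congr rfl fun j _ => ?_
  obtain ⟨c, U, hUm, hj⟩ := hU j
  rw [hj, smul_mul_mul_conjTranspose_smul, conjTranspose_smul_mul_smul, mul_one,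
    mul_conjTranspose_self_of_mem hUm, conjTranspose_mul_self_of_mem hUm]

/-- If `W` diagonalizes `ρ`, the operators `V * F j * Wᴴ` act on a diagonal matrix and inherit both
normalizations. -/
theorem QuantumChannel.IsUnital.isAverage_reDiag {Φ : QuantumChannel n} (h : Φ.IsUnital)
    (ρ : DensityMatrix n) {V : Matrix (Fin n) (Fin n) ℂ}
    (hV : V ∈ Matrix.unitaryGroup (Fin n) ℂ) :
    IsAverage (reDiag (V * (Φ.onState ρ).mat * Vᴴ)) ρ.eig := by
  obtain ⟨r, F, hF, hI⟩ := Φ.2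
  obtain ⟨W, hW, hWρ⟩ := exists_conj_eq_eigVec ρ.isHermitian
  have hone : ∑ j, F j * (F j)ᴴ = 1 := by
    have := (hF 1).symm.trans h
    simpa only [mul_one] using this
  have := isAverage_reDiag_sum (F := fun j => V * F j * Wᴴ) (by
    have e : ∀ j, V * F j * Wᴴ * (V * F j * Wᴴ)ᴴ = V * (F j * (F j)ᴴ) * Vᴴ := fun j => by
      simp only [Matrix.conjTranspose_mul, Matrix.conjTranspose_conjTranspose]
      calc V * F j * Wᴴ * (W * ((F j)ᴴ * Vᴴ)) = V * F j * (Wᴴ * W) * ((F j)ᴴ * Vᴴ) := by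
            simp only [Matrix.mul_assoc]
        _ = _ := by
          rw [conjTranspose_mul_self_of_mem hW, mul_one]
          simp only [Matrix.mul_assoc]
    rw [Finset.sum_congr rfl fun j _ => e j, ← Finset.sum_mul, ← Finset.mul_sum, hone, mul_one,
      mul_conjTranspose_self_of_mem hV]) (by
    have e : ∀ j, (V * F j * Wᴴ)ᴴ * (V * F j * Wᴴ) = W * ((F j)ᴴ * F j) * Wᴴ := fun j => by
      simp only [Matrix.conjTranspose_mul, Matrix.conjTranspose_conjTranspose]
      calc W * ((F j)ᴴ * Vᴴ) * (V * F j * Wᴴ) = W * (F j)ᴴ * (Vᴴ * V) * (F j * Wᴴ) := by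
            simp only [Matrix.mul_assoc]
        _ = _ := by
          rw [conjTranspose_mul_self_of_mem hV, mul_one]
          simp only [Matrix.mul_assoc]
    rw [Finset.sum_congr rfl fun j _ => e j, ← Finset.sum_mul, ← Finset.mul_sum, hI, mul_one,
      mul_conjTranspose_self_of_mem hW]) ρ.eig
  have e2 : V * (Φ.onState ρ).mat * Vᴴ =
      ∑ j, V * F j * Wᴴ * realDiag ρ.eig * (V * F j * Wᴴ)ᴴ := by
    have h1 : (Φ.onState ρ).mat = ∑ j, F j * ρ.mat * (F j)ᴴ := hF _
    rw [h1, Finset.mul_sum, Finset.sum_mul]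
    refine Finset.sum_congr rfl fun j _ => ?_
    rw [eq_conj_of_conj_eq hW hWρ]
    simp only [Matrix.conjTranspose_mul, Matrix.conjTranspose_conjTranspose, Matrix.mul_assoc]
    rfl
  rw [e2]
  exact this

theorem QuantumChannel.IsUnital.isAverage_eig {Φ : QuantumChannel n} (h : Φ.IsUnital)
    (ρ : DensityMatrix n) : IsAverage (Φ.onState ρ).eig ρ.eig := by
  obtain ⟨V, hV, hVρ⟩ := exists_conj_eq_eigVec (Φ.onState ρ).isHermitian
  have := h.isAverage_reDiag ρ hV
  rwa [hVρ, reDiag_realDiag] at this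

namespace DensityMatrix

theorem eig_antitone (ρ : DensityMatrix n) : Antitone ρ.eig := eigVec_antitone _

theorem frobSq_mat (ρ : DensityMatrix n) : frobSq ρ.mat = ∑ i, ρ.eig i ^ 2 :=
  frobSq_eq_sum_eigVec ρ.isHermitian

/-- Every vector majorized by the eigenvalues of `ρ` is realized, in a given orthonormal basis, as
the spectrum of a mixed unitary image of `ρ`. -/
theorem exists_isMixedUnitary_conj_eq (ρ : DensityMatrix n) {x : Fin n → ℝ}
    (hx : Majorized x ρ.eig) {V : Matrix (Fin n) (Fin n) ℂ}
    (hV : V ∈ Matrix.unitaryGroup (Fin n) ℂ) :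
    ∃ Φ : QuantumChannel n, Φ.IsMixedUnitary ∧ V * (Φ.onState ρ).mat * Vᴴ = realDiag x := by
  obtain ⟨w, hw0, hw1, hwx⟩ := hx.exists_perm_weights
  obtain ⟨W, hW, hWρ⟩ := exists_conj_eq_eigVec ρ.isHermitian
  -- Each unitary carries `ρ` to a diagonal matrix in the basis of `V`, with eigenvalues permuted by
  -- `π`; Rado's weights mix these into `x`.
  obtain ⟨Φ, hΦ, hΦX⟩ := exists_isMixedUnitary hw0 hw1 (U := fun π => Vᴴ * W.submatrix π id)
    fun π => mul_mem (conjTranspose_mem hV) (submatrix_mem_unitaryGroup hW π)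
  refine ⟨Φ, hΦ, conj_eq_of_eq_conj hV ((hΦX _).trans ?_)⟩
  have e : ∀ π : Equiv.Perm (Fin n), Vᴴ * W.submatrix π id * ρ.mat * (Vᴴ * W.submatrix π id)ᴴ =
      Vᴴ * realDiag (ρ.eig ∘ π) * V := fun π => by
    have := submatrix_conj_eq_realDiag hWρ π
    rw [show ρ.eig ∘ π = eigVec ρ.isHermitian ∘ π from rfl, ← this]
    simp only [Matrix.conjTranspose_mul, Matrix.conjTranspose_conjTranspose, Matrix.mul_assoc]
  have e2 : realDiag x = ∑ π, (w π : ℂ) • realDiag (ρ.eig ∘ π) := by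
    ext i j
    rw [Matrix.sum_apply]
    rcases eq_or_ne i j with rfl | hij
    · simp only [Matrix.smul_apply, realDiag_apply_self, hwx, smul_eq_mul, Function.comp_apply]
      push_cast
      rfl
    · simp [realDiag, Matrix.diagonal_apply_ne _ hij]
  rw [e2, Finset.mul_sum, Finset.sum_mul]
  refine Finset.sum_congr rfl fun π _ => ?_
  rw [e, mul_smul_comm, smul_mul_assoc]

end DensityMatrix

/-! ### Simultaneously diagonal pairs and the maximum -/

theorem spectralD_eq_of_conj (d : (Fin n → ℝ) → ℝ) {σ₁ σ₂ : DensityMatrix n} {x y : Fin n → ℝ}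
    {V : Matrix (Fin n) (Fin n) ℂ} (hV : V ∈ Matrix.unitaryGroup (Fin n) ℂ)
    (h₁ : V * σ₁.mat * Vᴴ = realDiag x) (h₂ : V * σ₂.mat * Vᴴ = realDiag y)
    (hxy : Antitone (x - y)) : spectralD d σ₁ σ₂ = d (x - y) := by
  rw [spectralD, eigVec_eq_of_conj _ hV ?_ hxy]
  rw [mul_sub, sub_mul, h₁, h₂, realDiag_sub]

theorem antitone_eig_sub_rev (ρ₁ ρ₂ : DensityMatrix n) :
    Antitone (ρ₁.eig - fun i => ρ₂.eig i.rev) := fun i j hij => by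
  have h1 := ρ₁.eig_antitone hij
  have h2 := antitone_neg_comp_rev ρ₂.eig_antitone hij
  simp only [Pi.sub_apply]
  linarith

theorem spectralD_diagDesc_diagAsc (d : (Fin n → ℝ) → ℝ) (ρ₁ ρ₂ : DensityMatrix n) :
    spectralD d ρ₁.diagDesc ρ₂.diagAsc = d (ρ₁.eig - fun i => ρ₂.eig i.rev) :=
  spectralD_eq_of_conj d (V := 1) (one_mem _) (by simp; rfl) (by simp; rfl)
    (antitone_eig_sub_rev ρ₁ ρ₂)

theorem majorized_sub_rev {Φ : QuantumChannel n} (hΦ : Φ.IsUnital) (ρ₁ ρ₂ : DensityMatrix n) :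
    Majorized (eigVec (ρ₁.isHermitian.sub (Φ.onState ρ₂).isHermitian))
      (ρ₁.eig - fun i => ρ₂.eig i.rev) := by
  have hX := ρ₁.isHermitian.sub (Φ.onState ρ₂).isHermitian
  obtain ⟨V, hV, hVX⟩ := exists_conj_eq_eigVec hX
  refine .of_prefixSum_le (eigVec_antitone _) (fun k => ?_) ?_
  · have e : eigVec hX = reDiag (V * ρ₁.mat * Vᴴ) - reDiag (V * (Φ.onState ρ₂).mat * Vᴴ) := by
      rw [eq_sub_iff_add_eq, ← reDiag_realDiag (eigVec hX), ← hVX, ← reDiag_add, ← add_mul,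
        ← mul_add, sub_add_cancel]
    rw [e, prefixSum_sub, prefixSum_sub]
    have h1 := (isAverage_reDiag_eigVec ρ₁.isHermitian hV).majorized.prefixSum_le ρ₁.eig_antitone k
    have h2 := (hΦ.isAverage_reDiag ρ₂ hV).prefixSum_rev_le ρ₂.eig_antitone k
    exact sub_le_sub h1 h2
  · apply Complex.ofReal_injective
    rw [sum_eigVec hX, Matrix.trace_sub, ρ₁.trace_mat, (Φ.onState ρ₂).trace_mat]
    have hrev : ∑ i : Fin n, ρ₂.eig i.rev = 1 :=
      (Equiv.sum_comp Fin.revPerm ρ₂.eig).trans ρ₂.sum_eig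
    simp [Finset.sum_sub_distrib, ρ₁.sum_eig, hrev]

/-- The equality case of Ky Fan's inequality for ρ₁ + (-Φ(ρ₂)). The norm hypothesis holds because
averaging the spectrum of ρ₂ does not increase its sum of squares. -/
theorem exists_conj_eq_of_eigVec_eq_sub_rev {Φ : QuantumChannel n} (hΦ : Φ.IsUnital)
    (ρ₁ ρ₂ : DensityMatrix n)
    (h : eigVec (ρ₁.isHermitian.sub (Φ.onState ρ₂).isHermitian) =
      ρ₁.eig - fun i => ρ₂.eig i.rev) :
    ∃ V ∈ Matrix.unitaryGroup (Fin n) ℂ, V * ρ₁.mat * Vᴴ = realDiag ρ₁.eig ∧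
      V * (Φ.onState ρ₂).mat * Vᴴ = realDiag fun i => ρ₂.eig i.rev := by
  obtain ⟨V, hV, hVX⟩ := exists_conj_eq_eigVec (ρ₁.isHermitian.sub (Φ.onState ρ₂).isHermitian)
  rw [h] at hVX
  have key := conj_eq_realDiag_of_add (Y := ρ₁.mat) (Z := -(Φ.onState ρ₂).mat) (y := ρ₁.eig)
    (z := -fun i => ρ₂.eig i.rev) ρ₁.isHermitian (Φ.onState ρ₂).isHermitian.neg hV
    (by rw [← sub_eq_add_neg, ← sub_eq_add_neg, hVX])
    (fun k => (isAverage_reDiag_eigVec ρ₁.isHermitian hV).majorized.prefixSum_le ρ₁.eig_antitone k)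
    (fun k => by
      have e : reDiag (V * -(Φ.onState ρ₂).mat * Vᴴ) =
          -reDiag (V * (Φ.onState ρ₂).mat * Vᴴ) := by
        ext i
        simp [reDiag]
      rw [e, prefixSum_neg, prefixSum_neg]
      exact neg_le_neg ((hΦ.isAverage_reDiag ρ₂ hV).prefixSum_rev_le ρ₂.eig_antitone k))
    ρ₁.frobSq_mat.le (by
      have e : frobSq (-(Φ.onState ρ₂).mat) = frobSq (Φ.onState ρ₂).mat := by simp [frobSq]
      rw [e, (Φ.onState ρ₂).frobSq_mat]
      refine ((hΦ.isAverage_eig ρ₂).majorized.sum_sq_le_of_antitone_right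
        ρ₂.eig_antitone).trans_eq ?_
      rw [← Equiv.sum_comp Fin.revPerm]
      simp)
  refine ⟨V, hV, key.1, ?_⟩
  have h2 := key.2
  have e : realDiag (-fun i : Fin n => ρ₂.eig i.rev) = -realDiag fun i => ρ₂.eig i.rev := by
    ext i j
    rcases eq_or_ne i j with rfl | hij
    · simp [realDiag_apply_self]
    · simp [realDiag, Matrix.diagonal_apply_ne _ hij]
  rw [e, mul_neg, neg_mul, neg_inj] at h2
  exact h2

/-! ### The minimum -/

section Minimum

variable {ρ₁ ρ₂ : DensityMatrix n} {Γ : Fin n → ℝ}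

/-- Sorting λ(ρ₁) - μ only raises prefix sums that already lie above those of λ(ρ₁) - λ(ρ₂), so the
minimality of `Γ` applies. -/
theorem IsTouchingMajorant.majorized_eig_sub (h : IsTouchingMajorant (ρ₁.eig - ρ₂.eig) Γ)
    (hΓ : Antitone Γ) {μ : Fin n → ℝ} (hμ : Majorized μ ρ₂.eig) : Majorized Γ (ρ₁.eig - μ) := by
  have hs : ∑ i, (ρ₁.eig - μ) i = ∑ i, (ρ₁.eig - ρ₂.eig) i := by
    simp only [Pi.sub_apply, Finset.sum_sub_distrib, hμ.2]
  refine ⟨fun k _ _ => ?_, h.sum_eq.trans hs.symm⟩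
  rw [sumLargest_of_antitone hΓ, sumLargest_eq_prefixSum]
  refine h.prefixSum_le_of_antitone (descSort_antitone _) (fun k => ?_) ((sum_descSort _).trans hs) k
  refine le_trans ?_ (prefixSum_le_sumLargest _ k)
  rw [prefixSum_sub, prefixSum_sub]
  linarith [hμ.prefixSum_le ρ₂.eig_antitone k]

theorem IsTouchingMajorant.majorized_eigVec (h : IsTouchingMajorant (ρ₁.eig - ρ₂.eig) Γ)
    (hΓ : Antitone Γ) {Φ : QuantumChannel n} (hΦ : Φ.IsUnital) :
    Majorized Γ (eigVec (ρ₁.isHermitian.sub (Φ.onState ρ₂).isHermitian)) :=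
  (h.majorized_eig_sub hΓ (hΦ.isAverage_eig ρ₂).majorized).trans
    (majorized_eigVec_sub ρ₁.isHermitian (Φ.onState ρ₂).isHermitian _)

/-- Put v = λ(ρ₁) - μ. Lidskii's theorem gives |v|² ≤ |Γ|², and ⟨Γ, v - Γ⟩ ≥ 0, so |v - Γ|² = |v|² -
|Γ|² - 2⟨Γ, v - Γ⟩ ≤ 0. -/
theorem IsTouchingMajorant.eig_eq (h : IsTouchingMajorant (ρ₁.eig - ρ₂.eig) Γ)
    (hΓ : Antitone Γ) {Φ : QuantumChannel n} (hΦ : Φ.IsUnital)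
    (he : eigVec (ρ₁.isHermitian.sub (Φ.onState ρ₂).isHermitian) = Γ) :
    (Φ.onState ρ₂).eig = ρ₁.eig - Γ := by
  set μ := (Φ.onState ρ₂).eig with hμ
  have hmaj := (hΦ.isAverage_eig ρ₂).majorized
  have h1 := majorized_eigVec_sub ρ₁.isHermitian (Φ.onState ρ₂).isHermitian
    (ρ₁.isHermitian.sub (Φ.onState ρ₂).isHermitian)
  rw [he] at h1
  have h2 : ∑ i, (ρ₁.eig i - μ i) ^ 2 ≤ ∑ i, Γ i ^ 2 := h1.sum_sq_le_of_antitone_right hΓ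
  have h3 : 0 ≤ ∑ i, Γ i * ((ρ₁.eig - μ) - Γ) i := by
    have hs : ∑ i, ((ρ₁.eig - μ) - Γ) i = 0 := by
      have e1 := h.sum_eq
      have e2 := hmaj.2
      simp only [Pi.sub_apply, Finset.sum_sub_distrib] at e1 ⊢
      linarith
    -- Only changes of `Γ` contribute; there its prefix sum is that of λ(ρ₁) - λ(ρ₂), which is at
    -- most that of λ(ρ₁) - μ.
    refine sum_mul_nonneg_of_prefixSum hs fun i j hij => ?_
    have hle : Γ j ≤ Γ i := hΓ (Fin.le_def.2 (by omega))
    by_cases hΓij : Γ i = Γ j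
    · rw [hΓij, sub_self, zero_mul]
    · refine mul_nonneg (sub_nonneg.2 hle) ?_
      have e1 := h.touch i j hij hΓij
      have e2 := hmaj.prefixSum_le ρ₂.eig_antitone j.val
      rw [prefixSum_sub] at e1
      rw [prefixSum_sub, prefixSum_sub]
      linarith
  have h4 : ∑ i, (ρ₁.eig i - μ i - Γ i) ^ 2 ≤ 0 := by
    have e : ∀ i, (ρ₁.eig i - μ i - Γ i) ^ 2 =
        (ρ₁.eig i - μ i) ^ 2 - Γ i ^ 2 - 2 * (Γ i * ((ρ₁.eig - μ) - Γ) i) := fun i => by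
      simp only [Pi.sub_apply]
      ring
    rw [Finset.sum_congr rfl fun i _ => e i, Finset.sum_sub_distrib, Finset.sum_sub_distrib,
      ← Finset.mul_sum]
    linarith
  have h5 := (Finset.sum_eq_zero_iff_of_nonneg fun i _ => sq_nonneg _).1
    (le_antisymm h4 (Finset.sum_nonneg fun i _ => sq_nonneg (ρ₁.eig i - μ i - Γ i)))
  ext i
  have := pow_eq_zero_iff (two_ne_zero) |>.1 (h5 i (Finset.mem_univ i))
  simp only [Pi.sub_apply]
  linarith

/-- The equality case of Ky Fan's inequality for ρ₁ = Φ(ρ₂) + (ρ₁ - Φ(ρ₂)), in an eigenbasis of ρ₁;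
by `eig_eq` the sorted spectra of the summands add up to that of ρ₁. -/
theorem IsTouchingMajorant.exists_conj_eq (h : IsTouchingMajorant (ρ₁.eig - ρ₂.eig) Γ)
    (hΓ : Antitone Γ) {Φ : QuantumChannel n} (hΦ : Φ.IsUnital)
    (he : eigVec (ρ₁.isHermitian.sub (Φ.onState ρ₂).isHermitian) = Γ) :
    ∃ V ∈ Matrix.unitaryGroup (Fin n) ℂ, V * ρ₁.mat * Vᴴ = realDiag ρ₁.eig ∧
      V * (Φ.onState ρ₂).mat * Vᴴ = realDiag (ρ₁.eig - Γ) := by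
  have hX := ρ₁.isHermitian.sub (Φ.onState ρ₂).isHermitian
  have hμ := h.eig_eq hΓ hΦ he
  obtain ⟨V, hV, hVρ⟩ := exists_conj_eq_eigVec ρ₁.isHermitian
  have key := conj_eq_realDiag_of_add (Y := (Φ.onState ρ₂).mat)
    (Z := ρ₁.mat - (Φ.onState ρ₂).mat) (y := ρ₁.eig - Γ) (z := Γ)
    (Φ.onState ρ₂).isHermitian hX hV (by rw [add_sub_cancel, sub_add_cancel, hVρ]; rfl)
    (fun k => by
      rw [← hμ]
      exact (isAverage_reDiag_eigVec (Φ.onState ρ₂).isHermitian hV).majorized.prefixSum_le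
        (Φ.onState ρ₂).eig_antitone k)
    (fun k => by
      have := (isAverage_reDiag_eigVec hX hV).majorized.prefixSum_le (eigVec_antitone hX) k
      rwa [he] at this)
    (by rw [← hμ]; exact (Φ.onState ρ₂).frobSq_mat.le)
    (by rw [frobSq_eq_sum_eigVec hX, he])
  exact ⟨V, hV, hVρ, key.1⟩

end Minimum

end

theorem theorem2p4 {n : ℕ} (d : (Fin n → ℝ) → ℝ) (hd : SchurConvex d)
    (ρ₁ ρ₂ : DensityMatrix n) (S : Set (QuantumChannel n))
    (hS : S = {Φ | Φ.IsMixedUnitary} ∨ S = {Φ | Φ.IsUnital}) :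
    -- the maximum
    IsGreatest ((fun Φ : QuantumChannel n => spectralD d ρ₁ (Φ.onState ρ₂)) '' S)
      (spectralD d ρ₁.diagDesc ρ₂.diagAsc) ∧
    (∀ Φ ∈ S,
      (∃ V ∈ Matrix.unitaryGroup (Fin n) ℂ, V * ρ₁.mat * Vᴴ = ρ₁.diagDesc.mat ∧
        V * (Φ.onState ρ₂).mat * Vᴴ = ρ₂.diagAsc.mat) →
      spectralD d ρ₁ (Φ.onState ρ₂) = spectralD d ρ₁.diagDesc ρ₂.diagAsc) ∧
    (StrictlySchurConvex d → ∀ Φ ∈ S,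
      spectralD d ρ₁ (Φ.onState ρ₂) = spectralD d ρ₁.diagDesc ρ₂.diagAsc →
      ∃ V ∈ Matrix.unitaryGroup (Fin n) ℂ, V * ρ₁.mat * Vᴴ = ρ₁.diagDesc.mat ∧
        V * (Φ.onState ρ₂).mat * Vᴴ = ρ₂.diagAsc.mat) ∧
    -- every run of the averaging algorithm terminates, and never gets stuck in Step 2
    Acc (fun Δ' Δ : Fin n → ℝ => AveragingStep Δ Δ') (ρ₁.eig - ρ₂.eig) ∧
    (∀ Δ : Fin n → ℝ, ¬ Antitone Δ → ∃! Δ', AveragingStep Δ Δ') ∧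
    -- its unique output is the diagonal of a state `τ`, which gives the minimum
    ∃ (e : Fin n → ℝ) (τ : DensityMatrix n),
      (∀ e', AveragingOutput ρ₁.eig ρ₂.eig e' ↔ e' = e) ∧
      τ.mat = realDiag e ∧
      IsLeast ((fun Φ : QuantumChannel n => spectralD d ρ₁ (Φ.onState ρ₂)) '' S)
        (spectralD d ρ₁.diagDesc τ) ∧
      (∀ Φ ∈ S,
        (∃ V ∈ Matrix.unitaryGroup (Fin n) ℂ, V * ρ₁.mat * Vᴴ = ρ₁.diagDesc.mat ∧
          V * (Φ.onState ρ₂).mat * Vᴴ = τ.mat) →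
        spectralD d ρ₁ (Φ.onState ρ₂) = spectralD d ρ₁.diagDesc τ) ∧
      (StrictlySchurConvex d → ∀ Φ ∈ S,
        spectralD d ρ₁ (Φ.onState ρ₂) = spectralD d ρ₁.diagDesc τ →
        ∃ V ∈ Matrix.unitaryGroup (Fin n) ℂ, V * ρ₁.mat * Vᴴ = ρ₁.diagDesc.mat ∧
          V * (Φ.onState ρ₂).mat * Vᴴ = τ.mat) := by
  -- Both choices of `S` lie between the mixed unitary and the unital channels; nothing else about
  -- `S` is needed.
  have hmixed : ∀ Φ : QuantumChannel n, Φ.IsMixedUnitary → Φ ∈ S := by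
    rcases hS with rfl | rfl
    exacts [fun _ h => h, fun _ h => h.isUnital]
  have hunital : ∀ Φ ∈ S, Φ.IsUnital := by
    rcases hS with rfl | rfl
    exacts [fun _ h => h.isUnital, fun _ h => h]
  clear hS
  obtain ⟨W, hW, hWρ⟩ := exists_conj_eq_eigVec ρ₁.isHermitian
  have hmax : ∀ Φ : QuantumChannel n,
      (∃ V ∈ Matrix.unitaryGroup (Fin n) ℂ, V * ρ₁.mat * Vᴴ = ρ₁.diagDesc.mat ∧
        V * (Φ.onState ρ₂).mat * Vᴴ = ρ₂.diagAsc.mat) →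
      spectralD d ρ₁ (Φ.onState ρ₂) = spectralD d ρ₁.diagDesc ρ₂.diagAsc := by
    rintro Φ ⟨V, hV, h1, h2⟩
    rw [spectralD_diagDesc_diagAsc]
    exact spectralD_eq_of_conj d hV h1 h2 (antitone_eig_sub_rev ρ₁ ρ₂)
  refine ⟨⟨?_, ?_⟩, fun Φ _ => hmax Φ, fun hs Φ hΦ he => ?_, wellFounded_averagingStep.apply _,
    fun Δ => existsUnique_averagingStep, ?_⟩
  · have hrev : Majorized (fun i => ρ₂.eig i.rev) ρ₂.eig :=
      ⟨fun k _ _ => (sumLargest_comp_perm ρ₂.eig Fin.revPerm k).le,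
        Equiv.sum_comp Fin.revPerm ρ₂.eig⟩
    obtain ⟨Φ, hΦ, hΦW⟩ := ρ₂.exists_isMixedUnitary_conj_eq hrev hW
    exact ⟨Φ, hmixed Φ hΦ, hmax Φ ⟨W, hW, hWρ, hΦW⟩⟩
  · rintro _ ⟨Φ, hΦ, rfl⟩
    rw [spectralD_diagDesc_diagAsc]
    exact hd _ _ (majorized_sub_rev (hunital Φ hΦ) ρ₁ ρ₂)
  · rw [spectralD_diagDesc_diagAsc] at he
    obtain ⟨π, hπ⟩ := hs.eq_comp_perm (majorized_sub_rev (hunital Φ hΦ) ρ₁ ρ₂) he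
    exact exists_conj_eq_of_eigVec_eq_sub_rev (hunital Φ hΦ) ρ₁ ρ₂
      (eq_of_antitone_of_comp_perm (eigVec_antitone _) (antitone_eig_sub_rev ρ₁ ρ₂) hπ)
  obtain ⟨Γ, hout, hΓ, hT⟩ := exists_averagingOutput ρ₁.eig ρ₂.eig
  have hsub : ρ₁.eig - (ρ₁.eig - Γ) = Γ := sub_sub_cancel _ _
  let τ : DensityMatrix n := ⟨realDiag (ρ₁.eig - Γ), DensityMatrix.realDiag_mem
    (hT.nonneg ρ₁.eig_antitone ρ₂.eig_antitone ρ₂.eig_nonneg) (hT.sum_sub.trans ρ₂.sum_eig)⟩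
  have hτ : τ.mat = realDiag (ρ₁.eig - Γ) := rfl
  have hval : spectralD d ρ₁.diagDesc τ = d Γ := by
    rw [spectralD_eq_of_conj d (V := 1) (x := ρ₁.eig) (y := ρ₁.eig - Γ) (one_mem _) (by simp; rfl)
      (by simp; rfl) (by rwa [hsub]), hsub]
  have hmin : ∀ Φ : QuantumChannel n,
      (∃ V ∈ Matrix.unitaryGroup (Fin n) ℂ, V * ρ₁.mat * Vᴴ = ρ₁.diagDesc.mat ∧
        V * (Φ.onState ρ₂).mat * Vᴴ = τ.mat) →
      spectralD d ρ₁ (Φ.onState ρ₂) = spectralD d ρ₁.diagDesc τ := by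
    rintro Φ ⟨V, hV, h1, h2⟩
    rw [hval, spectralD_eq_of_conj d (x := ρ₁.eig) (y := ρ₁.eig - Γ) hV h1 h2 (by rwa [hsub]), hsub]
  refine ⟨_, τ, hout, hτ, ⟨?_, ?_⟩, fun Φ _ => hmin Φ, fun hs Φ hΦ he => ?_⟩
  · obtain ⟨Φ, hΦ, hΦW⟩ := ρ₂.exists_isMixedUnitary_conj_eq
      (hT.majorized ρ₁.eig_antitone ρ₂.eig_antitone) hW
    exact ⟨Φ, hmixed Φ hΦ, hmin Φ ⟨W, hW, hWρ, hΦW⟩⟩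
  · rintro _ ⟨Φ, hΦ, rfl⟩
    rw [hval]
    exact hd _ _ (hT.majorized_eigVec hΓ (hunital Φ hΦ))
  · rw [hval] at he
    obtain ⟨π, hπ⟩ := hs.eq_comp_perm (hT.majorized_eigVec hΓ (hunital Φ hΦ)) he.symm
    exact hT.exists_conj_eq hΓ (hunital Φ hΦ)
      (eq_of_antitone_of_comp_perm hΓ (eigVec_antitone _) hπ).symm
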